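/- **Setting.** Let $\mathbb R^{u}\times\mathbb R^{s}$ carry the Euclidean norm, with points $z=(\mathrm x,\mathrm y)$. For a square matrix $A$ put $m(A)=\min_{\|z\|=1}\|Az\|$ and let $$l(A)=\lim_{h\to0^+}\frac{\|I+hA\|-\|I\|}{h},\qquad m_l(A)=\lim_{h\to0^+}\frac{m(I+hA)-\|I\|}{h}$$ be its logarithmic norm and its logarithmic minimum. Let $D\subset\mathbb R^{u}\times\mathbb R^{s}$, let $X=\{\mathrm x : (\mathrm x,\mathrm y)\in D \text{ for some } \mathrm y\}$, and let $f=(f_{\mathrm x},f_{\mathrm y})$ be a vector field of class $C^3$ in a neighbourhood of every point of $D$ whose first and second derivatives are bounded on $D$. For $h>0$ let $F=\Phi(h,\cdot)$ be the time-$h$ shift along the solutions of $z'=f(z)$ that stay in $D$ during $[0,h]$. For $v:X\to\mathbb R^s$ the graph transform is $$\mathcal G_h(v)=F_{\mathrm y}\circ(\mathrm{id},v)\circ\bigl(F_{\mathrm x}\circ(\mathrm{id},v)\bigr)^{-1};$$ it is well defined if every $\mathrm x\in X$ has exactly one preimage in $X$ under $F_{\mathrm x}\circ(\mathrm{id},v)$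 and this preimage depends continuously on $\mathrm x$. Suppose that there are $h_0>0$ and $w:X\to\mathbb R^s$ such that for every $h\in(0,h_0]$ all iterates $\mathcal G_h^n(v_0)$ of $v_0=0$ are well defined and $$w=\lim_{n\to\infty}\mathcal G_h^n(v_0)\quad\text{pointwise on }X.$$ **Theorem.** Let $\mathcal L>0$ and $$\xi=\inf_{D}m_l\Bigl(\frac{\partial f_{\mathrm x}}{\partial\mathrm x}\Bigr)-\mathcal L\sup_{D}\Bigl\|\frac{\partial f_{\mathrm x}}{\partial\mathrm y}\Bigr\|,\quad \mu_1=\sup_{D}l\Bigl(\frac{\partial f_{\mathrm y}}{\partial\mathrm y}\Bigr)+\frac1{\mathcal L}\sup_{D}\Bigl\|\frac{\partial f_{\mathrm y}}{\partial\mathrm x}\Bigr\|,\quad \mu_2=\sup_{D}l\Bigl(\frac{\partial f_{\mathrm y}}{\partial\mathrm y}\Bigr)+\mathcal L\sup_{D}\Bigl\|\frac{\partial f_{\mathrm x}}{\partial\mathrm y}\Bigr\|.$$ Assume $\mu_1<\xi$ and $\mu_2<2\xi$. Let $$C_x=\tfrac12\sup_{p\in D,\|v\|=1}\|D^2f_{\mathrm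 x}(p)(v,v)\|,\qquad C_y=\tfrac12\sup_{p\in D,\|v\|=1}\|D^2f_{\mathrm y}(p)(v,v)\|,$$ $$C_{y,1}=\sup_D\tfrac12\Bigl\|\frac{\partial^2f_{\mathrm y}}{\partial\mathrm x^2}\Bigr\|,\qquad C_{y,2}=\sup_D\Bigl\|\frac{\partial^2f_{\mathrm y}}{\partial\mathrm x\,\partial\mathrm y}\Bigr\|,\qquad C_{y,3}=\sup_D\tfrac12\Bigl\|\frac{\partial^2f_{\mathrm y}}{\partial\mathrm y^2}\Bigr\|.$$ Let $M$ satisfy at least one of $$M>\frac{(\mathcal LC_x+C_y)(1+\mathcal L^2)}{2\xi-\mu_2},\qquad M>\frac{\mathcal LC_x(1+\mathcal L^2)+C_{y,1}+C_{y,2}\mathcal L+C_{y,3}\mathcal L^2}{2\xi-\mu_2}.$$ Then on every convex set $K\subset X$ with non-empty interior (for instance $K=X$, if $X$ is such a set, or a ball around an interior point of $X$) the function $w$ is differentiable, where derivatives are taken within $K$, and for all $\mathrm x\in K$ and $v$ with $\mathrm x+v\in K$ $$w(\mathrm x+v)=w(\mathrm x)+Dw(\mathrm x)v+\Delta y(\mathrm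 x,v),\qquad\|\Delta y(\mathrm x,v)\|\le M\|v\|^2 .$$ Consequently, at every $\mathrm x\in K$ at which the second derivative of $w$ exists, $$\bigl\|\tfrac12D^2w(\mathrm x)(v,v)\bigr\|\le M\|v\|^2\qquad\text{for all }v\in\mathbb R^u .$$ -/

import Mathlib

open Set Filter Topology

noncomputable section

namespace SecondDerivBound

/-! ### Logarithmic norm and logarithmic minimum -/

section LogNorm

variable {V : Type*} [NormedAddCommGroup V] [NormedSpace ℝ V]

/-- `m(A)`, the minimum of `‖A z‖` over the unit sphere. -/
def minNorm (A : V →L[ℝ] V) : ℝ := sInf ((fun z => ‖A z‖) '' Metric.sphere (0 : V) 1)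

/-- The logarithmic norm `l(A) = lim_{h → 0+} (‖I + h A‖ - ‖I‖) / h`. -/
def logNorm (A : V →L[ℝ] V) : ℝ :=
  limUnder (𝓝[>] (0 : ℝ)) fun h : ℝ =>
    (‖ContinuousLinearMap.id ℝ V + h • A‖ - ‖ContinuousLinearMap.id ℝ V‖) / h

/-- The logarithmic minimum `m_l(A) = lim_{h → 0+} (m(I + h A) - ‖I‖) / h`. -/
def logMin (A : V →L[ℝ] V) : ℝ :=
  limUnder (𝓝[>] (0 : ℝ)) fun h : ℝ =>
    (minNorm (ContinuousLinearMap.id ℝ V + h • A) - ‖ContinuousLinearMap.id ℝ V‖) / h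

/-- The limit defining the logarithmic norm exists. -/
theorem tendsto_logNorm (A : V →L[ℝ] V) :
    Tendsto (fun h : ℝ =>
      (‖ContinuousLinearMap.id ℝ V + h • A‖ - ‖ContinuousLinearMap.id ℝ V‖) / h)
      (𝓝[>] (0 : ℝ)) (𝓝 (logNorm A)) := by
  set I := ContinuousLinearMap.id ℝ V with hI
  have hmono : MonotoneOn (fun h : ℝ => (‖I + h • A‖ - ‖I‖) / h) (Ioi 0) := by
    intro h hh k hk hle
    have hh' : (0 : ℝ) < h := hh
    have hk' : (0 : ℝ) < k := hk
    have hc : h / k ≤ 1 := (div_le_one hk').2 hle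
    have e : I + h • A = (1 - h / k) • I + (h / k) • (I + k • A) := by
      rw [smul_add, smul_smul, div_mul_cancel₀ h hk'.ne', sub_smul, one_smul]
      abel
    have h1 : ‖I + h • A‖ ≤ (1 - h / k) * ‖I‖ + (h / k) * ‖I + k • A‖ := by
      rw [e]
      refine (norm_add_le _ _).trans ?_
      rw [norm_smul, norm_smul, Real.norm_of_nonneg (by linarith),
        Real.norm_of_nonneg (by positivity)]
    change (‖I + h • A‖ - ‖I‖) / h ≤ (‖I + k • A‖ - ‖I‖) / k
    rw [div_le_iff₀ hh']
    calc ‖I + h • A‖ - ‖I‖ ≤ (1 - h / k) * ‖I‖ + (h / k) * ‖I + k • A‖ - ‖I‖ := by linarith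
      _ = (‖I + k • A‖ - ‖I‖) / k * h := by field_simp; ring
  have hbdd : BddBelow ((fun h : ℝ => (‖I + h • A‖ - ‖I‖) / h) '' Ioi 0) := by
    refine ⟨-‖A‖, ?_⟩
    rintro _ ⟨h, hh, rfl⟩
    have hh' : (0 : ℝ) < h := hh
    change -‖A‖ ≤ (‖I + h • A‖ - ‖I‖) / h
    rw [le_div_iff₀ hh']
    have h2 : ‖I‖ ≤ ‖I + h • A‖ + ‖h • A‖ := by
      simpa using norm_sub_le (I + h • A) (h • A)
    rw [norm_smul, Real.norm_of_nonneg hh'.le] at h2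
    linarith
  exact tendsto_nhds_limUnder ⟨_, hmono.tendsto_nhdsGT hbdd⟩

end LogNorm

/-- For a Euclidean norm the limit defining the logarithmic minimum exists. -/
theorem tendsto_logMin {V : Type*} [NormedAddCommGroup V] [InnerProductSpace ℝ V]
    (A : V →L[ℝ] V) :
    Tendsto (fun h : ℝ =>
      (minNorm (ContinuousLinearMap.id ℝ V + h • A) - ‖ContinuousLinearMap.id ℝ V‖) / h)
      (𝓝[>] (0 : ℝ)) (𝓝 (logMin A)) := by
  refine tendsto_nhds_limUnder ?_
  rcases subsingleton_or_nontrivial V with hV | hV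
  · refine ⟨0, ?_⟩
    have hs : Metric.sphere (0 : V) 1 = ∅ := by
      ext z
      simp [Subsingleton.elim z 0]
    have hI : ContinuousLinearMap.id ℝ V = 0 := by
      ext z
      exact Subsingleton.elim _ _
    simp [minNorm, hs, hI]
  · have hne : (Metric.sphere (0 : V) 1).Nonempty := by
      obtain ⟨z, hz⟩ := exists_norm_eq V (zero_le_one : (0 : ℝ) ≤ 1)
      exact ⟨z, by simpa using hz⟩
    set S := (fun z => inner ℝ z (A z)) '' Metric.sphere (0 : V) 1 with hS
    have hSb : BddBelow S := by
      refine ⟨-‖A‖, ?_⟩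
      rintro _ ⟨z, hz, rfl⟩
      have hz' : ‖z‖ = 1 := by simpa using hz
      have h1 := abs_le.1 (abs_real_inner_le_norm z (A z))
      have h2 := A.le_opNorm z
      rw [hz'] at h1 h2
      change -‖A‖ ≤ inner ℝ z (A z)
      linarith [h1.1]
    refine ⟨sInf S, ?_⟩
    have hsq : ∀ (h : ℝ) (z : V), ‖z‖ = 1 →
        ‖z + h • A z‖ ^ 2 = 1 + 2 * (h * inner ℝ z (A z)) + h ^ 2 * ‖A z‖ ^ 2 := by
      intro h z hz
      rw [norm_add_sq_real, hz, real_inner_smul_right, norm_smul, mul_pow, Real.norm_eq_abs,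
        sq_abs]
      ring
    have hlow : ∀ h : ℝ, 0 < h → 1 + h * sInf S ≤
        minNorm (ContinuousLinearMap.id ℝ V + h • A) := by
      intro h hh
      refine le_csInf (hne.image _) ?_
      rintro _ ⟨z, hz, rfl⟩
      have hz' : ‖z‖ = 1 := by simpa using hz
      have h1 : sInf S ≤ inner ℝ z (A z) := csInf_le hSb ⟨z, hz, rfl⟩
      have h2 := real_inner_le_norm z (z + h • A z)
      rw [inner_add_right, real_inner_smul_right, real_inner_self_eq_norm_sq, hz'] at h2
      change 1 + h * sInf S ≤ ‖z + h • A z‖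
      nlinarith
    have hupp : ∀ h : ℝ, 0 < h → minNorm (ContinuousLinearMap.id ℝ V + h • A) ≤
        1 + h * sInf S + h ^ 2 * ‖A‖ ^ 2 / 2 := by
      intro h hh
      have key : ∀ b ∈ S,
          (minNorm (ContinuousLinearMap.id ℝ V + h • A) - 1 - h ^ 2 * ‖A‖ ^ 2 / 2) / h ≤ b := by
        rintro _ ⟨z, hz, rfl⟩
        have hz' : ‖z‖ = 1 := by simpa using hz
        have hm : minNorm (ContinuousLinearMap.id ℝ V + h • A) ≤ ‖z + h • A z‖ :=
          csInf_le ⟨0, by rintro _ ⟨y, _, rfl⟩; exact norm_nonneg _⟩ ⟨z, hz, rfl⟩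
        have h2 := A.le_opNorm z
        rw [hz', mul_one] at h2
        have h3 : ‖A z‖ ^ 2 ≤ ‖A‖ ^ 2 := pow_le_pow_left₀ (norm_nonneg _) h2 2
        have h4 := hsq h z hz'
        have h5 : h ^ 2 * ‖A z‖ ^ 2 ≤ h ^ 2 * ‖A‖ ^ 2 :=
          mul_le_mul_of_nonneg_left h3 (sq_nonneg h)
        change _ ≤ inner ℝ z (A z)
        rw [div_le_iff₀ hh]
        nlinarith [sq_nonneg (‖z + h • A z‖ - 1)]
      have h6 := le_csInf (hne.image _) key
      rw [div_le_iff₀ hh] at h6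
      nlinarith
    have hlim : Tendsto (fun h : ℝ => sInf S + h * ‖A‖ ^ 2 / 2) (𝓝[>] 0) (𝓝 (sInf S)) := by
      have hcont : Continuous fun h : ℝ => sInf S + h * ‖A‖ ^ 2 / 2 := by fun_prop
      simpa using (hcont.tendsto 0).mono_left nhdsWithin_le_nhds
    refine tendsto_of_tendsto_of_tendsto_of_le_of_le' tendsto_const_nhds hlim ?_ ?_
    · filter_upwards [self_mem_nhdsWithin] with h hh
      have hh' : (0 : ℝ) < h := hh
      rw [ContinuousLinearMap.norm_id, le_div_iff₀ hh']
      nlinarith [hlow h hh']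
    · filter_upwards [self_mem_nhdsWithin] with h hh
      have hh' : (0 : ℝ) < h := hh
      rw [ContinuousLinearMap.norm_id, div_le_iff₀ hh']
      nlinarith [hupp h hh']

/-! ### The phase space and the blocks of the derivatives of the vector field -/

/-- `ℝ^u × ℝ^s` with the Euclidean norm. -/
abbrev Phase (u s : ℕ) : Type :=
  WithLp 2 (EuclideanSpace ℝ (Fin u) × EuclideanSpace ℝ (Fin s))

variable {u s : ℕ}

instance instContinuousSMulPhase : ContinuousSMul ℝ (Phase u s) := IsBoundedSMul.continuousSMul

/-- The point `(x, y)`. -/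
abbrev pt (x : EuclideanSpace ℝ (Fin u)) (y : EuclideanSpace ℝ (Fin s)) : Phase u s :=
  WithLp.toLp 2 (x, y)

/-- The inclusion `x ↦ (x, 0)`. -/
def inX (u s : ℕ) : EuclideanSpace ℝ (Fin u) →L[ℝ] Phase u s :=
  ((WithLp.prodContinuousLinearEquiv 2 ℝ (EuclideanSpace ℝ (Fin u))
    (EuclideanSpace ℝ (Fin s))).symm : _ →L[ℝ] Phase u s).comp
    (ContinuousLinearMap.inl ℝ (EuclideanSpace ℝ (Fin u)) (EuclideanSpace ℝ (Fin s)))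

/-- The inclusion `y ↦ (0, y)`. -/
def inY (u s : ℕ) : EuclideanSpace ℝ (Fin s) →L[ℝ] Phase u s :=
  ((WithLp.prodContinuousLinearEquiv 2 ℝ (EuclideanSpace ℝ (Fin u))
    (EuclideanSpace ℝ (Fin s))).symm : _ →L[ℝ] Phase u s).comp
    (ContinuousLinearMap.inr ℝ (EuclideanSpace ℝ (Fin u)) (EuclideanSpace ℝ (Fin s)))

theorem inX_apply (x : EuclideanSpace ℝ (Fin u)) : inX u s x = pt x 0 := rfl

theorem inY_apply (y : EuclideanSpace ℝ (Fin s)) : inY u s y = pt 0 y := rfl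

/-- The component `f_x`. -/
def compX (f : Phase u s → Phase u s) (z : Phase u s) : EuclideanSpace ℝ (Fin u) := (f z).fst

/-- The component `f_y`. -/
def compY (f : Phase u s → Phase u s) (z : Phase u s) : EuclideanSpace ℝ (Fin s) := (f z).snd

/-- `∂f_x/∂x (z)`. -/
def dXX (f : Phase u s → Phase u s) (z : Phase u s) :
    EuclideanSpace ℝ (Fin u) →L[ℝ] EuclideanSpace ℝ (Fin u) :=
  (fderiv ℝ (compX f) z).comp (inX u s)

/-- `∂f_x/∂y (z)`. -/
def dXY (f : Phase u s → Phase u s) (z : Phase u s) :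
    EuclideanSpace ℝ (Fin s) →L[ℝ] EuclideanSpace ℝ (Fin u) :=
  (fderiv ℝ (compX f) z).comp (inY u s)

/-- `∂f_y/∂x (z)`. -/
def dYX (f : Phase u s → Phase u s) (z : Phase u s) :
    EuclideanSpace ℝ (Fin u) →L[ℝ] EuclideanSpace ℝ (Fin s) :=
  (fderiv ℝ (compY f) z).comp (inX u s)

/-- `∂f_y/∂y (z)`. -/
def dYY (f : Phase u s → Phase u s) (z : Phase u s) :
    EuclideanSpace ℝ (Fin s) →L[ℝ] EuclideanSpace ℝ (Fin s) :=
  (fderiv ℝ (compY f) z).comp (inY u s)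

/-! ### The constants computed from the vector field -/

/-- `inf_D m_l(∂f_x/∂x) - 𝓛 sup_D ‖∂f_x/∂y‖`. -/
def xiRate (f : Phase u s → Phase u s) (D : Set (Phase u s)) (L : ℝ) : ℝ :=
  sInf ((fun z => logMin (dXX f z)) '' D) - L * sSup ((fun z => ‖dXY f z‖) '' D)

/-- `sup_D l(∂f_y/∂y) + 𝓛⁻¹ sup_D ‖∂f_y/∂x‖`. -/
def muRate₁ (f : Phase u s → Phase u s) (D : Set (Phase u s)) (L : ℝ) : ℝ :=
  sSup ((fun z => logNorm (dYY f z)) '' D) + 1 / L * sSup ((fun z => ‖dYX f z‖) '' D)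

/-- `sup_D l(∂f_y/∂y) + 𝓛 sup_D ‖∂f_x/∂y‖`. -/
def muRate₂ (f : Phase u s → Phase u s) (D : Set (Phase u s)) (L : ℝ) : ℝ :=
  sSup ((fun z => logNorm (dYY f z)) '' D) + L * sSup ((fun z => ‖dXY f z‖) '' D)

/-- `C_x = ½ sup_{p ∈ D, ‖v‖ = 1} ‖D²f_x(p)(v, v)‖`. -/
def cX (f : Phase u s → Phase u s) (D : Set (Phase u s)) : ℝ :=
  1 / 2 * sSup {r | ∃ p ∈ D, ∃ v : Phase u s, ‖v‖ = 1 ∧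
    r = ‖fderiv ℝ (fderiv ℝ (compX f)) p v v‖}

/-- `C_y = ½ sup_{p ∈ D, ‖v‖ = 1} ‖D²f_y(p)(v, v)‖`. -/
def cY (f : Phase u s → Phase u s) (D : Set (Phase u s)) : ℝ :=
  1 / 2 * sSup {r | ∃ p ∈ D, ∃ v : Phase u s, ‖v‖ = 1 ∧
    r = ‖fderiv ℝ (fderiv ℝ (compY f)) p v v‖}

/-- `C_{y,1} = sup_D ½ ‖∂²f_y/∂x²‖`, with the norm of bilinear maps. -/
def cY₁ (f : Phase u s → Phase u s) (D : Set (Phase u s)) : ℝ :=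
  sSup ((fun p => 1 / 2 *
    ‖(fderiv ℝ (fderiv ℝ (compY f)) p).bilinearComp (inX u s) (inX u s)‖) '' D)

/-- `C_{y,2} = sup_D ‖∂²f_y/∂x∂y‖`, with the norm of bilinear maps. -/
def cY₂ (f : Phase u s → Phase u s) (D : Set (Phase u s)) : ℝ :=
  sSup ((fun p =>
    ‖(fderiv ℝ (fderiv ℝ (compY f)) p).bilinearComp (inX u s) (inY u s)‖) '' D)

/-- `C_{y,3} = sup_D ½ ‖∂²f_y/∂y²‖`, with the norm of bilinear maps. -/
def cY₃ (f : Phase u s → Phase u s) (D : Set (Phase u s)) : ℝ :=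
  sSup ((fun p => 1 / 2 *
    ‖(fderiv ℝ (fderiv ℝ (compY f)) p).bilinearComp (inY u s) (inY u s)‖) '' D)

/-! ### The time-`h` shift and its graph transform -/

/-- `Φ(h, p) = q` for the flow of `z' = f(z)` in `D`: a solution that stays in `D` during `[0, h]`
leads from `p` to `q`. -/
def FlowsTo (f : Phase u s → Phase u s) (D : Set (Phase u s)) (h : ℝ) (p q : Phase u s) : Prop :=
  ∃ γ : ℝ → Phase u s, γ 0 = p ∧ γ h = q ∧
    ∀ t ∈ Icc (0 : ℝ) h, γ t ∈ D ∧ HasDerivWithinAt γ (f (γ t)) (Icc (0 : ℝ) h) t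

/-- The projection of `D` to the `x`-coordinate, on which the functions `v` live. -/
def projX (D : Set (Phase u s)) : Set (EuclideanSpace ℝ (Fin u)) := {x | ∃ y, pt x y ∈ D}

/-- The graph transform of `v` under `F = Φ(h, ·)` is well defined and equal to `v'`, that is
`v' = F_y ∘ (id, v) ∘ (F_x ∘ (id, v))⁻¹` on `projX D`. Here `r` is the (continuous) inverse of
`F_x ∘ (id, v)`: every `x` has the preimage `r x`, and no other one. -/
def IsGraphTransform (f : Phase u s → Phase u s) (D : Set (Phase u s)) (h : ℝ)
    (v v' : EuclideanSpace ℝ (Fin u) → EuclideanSpace ℝ (Fin s)) : Prop :=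
  ∃ r : EuclideanSpace ℝ (Fin u) → EuclideanSpace ℝ (Fin u),
    ContinuousOn r (projX D) ∧ MapsTo r (projX D) (projX D) ∧
    (∀ x ∈ projX D, FlowsTo f D h (pt (r x) (v (r x))) (pt x (v' x))) ∧
    (∀ x ∈ projX D, ∀ x₀ ∈ projX D, ∀ y, FlowsTo f D h (pt x₀ (v x₀)) (pt x y) → x₀ = r x)

/-- `w = lim_{n → ∞} 𝓖ⁿ(v₀)` with `v₀ = 0`, where `𝓖` is the graph transform of `Φ(h, ·)`; all
iterates are required to be well defined. -/
def IsGraphLimit (f : Phase u s → Phase u s) (D : Set (Phase u s)) (h : ℝ)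
    (w : EuclideanSpace ℝ (Fin u) → EuclideanSpace ℝ (Fin s)) : Prop :=
  ∃ V : ℕ → EuclideanSpace ℝ (Fin u) → EuclideanSpace ℝ (Fin s),
    V 0 = 0 ∧ (∀ n, IsGraphTransform f D h (V n) (V (n + 1))) ∧
    ∀ x ∈ projX D, Tendsto (fun n => V n x) atTop (𝓝 (w x))

end SecondDerivBound

end

/-!
Let `V n` be the iterates of the graph transform. Everything happens along single trajectories, and
one step size `h` is enough. No smooth dependence of the flow on initial values is used; instead
pairs of trajectories are compared.

Fix a trajectory in `D`, with blocks `A`, `B`, `C`, `N` of the derivative of `f` along it. If it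
lies on a moving invariant graph, the slope `S` of the graph at the trajectory solves the Riccati
equation `S' = C + N S - S A - S B S`. The condition `muRate₁ < xiRate` makes the norm of `S`
decrease on the sphere `‖S‖ = L`, so solutions starting in the ball of radius `L` exist for all
times and stay there (`exists_riccati_solution`). Now let `d` be the displacement to a neighbouring
trajectory, `a` its horizontal part and `e` the deviation of its vertical part from `S a`. The
Riccati equation removes the terms linear in `a` from `e'`, and up to small errors `‖e‖` grows at
rate at most `muRate₂` with forcing `Γ ‖a‖²`, where `Γ` bounds the contribution of the second
derivatives of `f` (either of the two numerators in the hypothesis on `M`), while `‖a‖` grows at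
rate at least `xiRate` (`RateBounds.displacement_bounds`). Since `Γ < M (2 xiRate - muRate₂)`, the
region `‖e‖ ≤ M ‖a‖²` is positively invariant near the trajectory
(`norm_le_mul_sq_of_deriv_bounds`, `RateBounds.exists_slope_transport`).

Hence, by induction on `n` starting from `V 0 = 0`, at each point of `projX D` the function `V n`
has a slope of norm at most `L` with first-order remainder at most `M ‖x' - x‖²` near that point.
The size of the neighbourhood is not controlled, but on a segment such local estimates with a
uniform constant add up to the global one: a component of `V n` along the segment, plus a multiple
of `M t²`, lies locally above a line through each point of its graph, and therefore globally above
the line at the starting point (`norm_taylor_le_of_local`). By compactness of the ball of slopes the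
estimate passes to the limit `w`. The bound for the second derivative follows from a second-order
expansion at base points moved into the interior of `K` (`norm_second_fderivWithin_le`).
-/

namespace SecondDerivBound

/-! ### Numerical-range bounds from the logarithmic norm and minimum -/

theorem logNorm_le_norm {V : Type*} [NormedAddCommGroup V] [NormedSpace ℝ V] (A : V →L[ℝ] V) :
    logNorm A ≤ ‖A‖ := by
  refine le_of_tendsto (tendsto_logNorm A) ?_
  filter_upwards [self_mem_nhdsWithin] with h hh
  have hh' : (0 : ℝ) < h := hh
  rw [div_le_iff₀ hh']
  have := norm_add_le (ContinuousLinearMap.id ℝ V) (h • A)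
  rw [norm_smul, Real.norm_of_nonneg hh'.le] at this
  linarith

theorem inner_map_le_logNorm {V : Type*} [NormedAddCommGroup V] [InnerProductSpace ℝ V]
    (A : V →L[ℝ] V) (z : V) : inner ℝ z (A z) ≤ logNorm A * ‖z‖ ^ 2 := by
  rcases subsingleton_or_nontrivial V with hV | hV
  · simp [Subsingleton.elim z 0]
  refine ge_of_tendsto ((tendsto_logNorm A).mul_const (‖z‖ ^ 2)) ?_
  filter_upwards [self_mem_nhdsWithin] with h hh
  have hh' : (0 : ℝ) < h := hh
  rw [ContinuousLinearMap.norm_id, div_mul_eq_mul_div, le_div_iff₀ hh']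
  have h1 := real_inner_le_norm z ((ContinuousLinearMap.id ℝ V + h • A) z)
  have h2 := (ContinuousLinearMap.id ℝ V + h • A).le_opNorm z
  have h3 := mul_le_mul_of_nonneg_left h2 (norm_nonneg z)
  have h4 : inner ℝ z ((ContinuousLinearMap.id ℝ V + h • A) z) = ‖z‖ ^ 2 + h * inner ℝ z (A z) := by
    simp [inner_add_right, real_inner_smul_right]
  nlinarith

theorem neg_norm_le_logMin {V : Type*} [NormedAddCommGroup V] [InnerProductSpace ℝ V]
    (A : V →L[ℝ] V) : -‖A‖ ≤ logMin A := by
  refine ge_of_tendsto (tendsto_logMin A) ?_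
  filter_upwards [self_mem_nhdsWithin] with h hh
  have hh' : (0 : ℝ) < h := hh
  rw [le_div_iff₀ hh']
  rcases subsingleton_or_nontrivial V with hV | hV
  · have hs : Metric.sphere (0 : V) 1 = ∅ := by
      ext z
      simp [Subsingleton.elim z 0]
    have hI : ContinuousLinearMap.id ℝ V = 0 := by
      ext z
      exact Subsingleton.elim _ _
    simp [minNorm, hs, hI]
  · have hne : (Metric.sphere (0 : V) 1).Nonempty := by
      obtain ⟨z, hz⟩ := exists_norm_eq V (zero_le_one : (0 : ℝ) ≤ 1)
      exact ⟨z, by simpa using hz⟩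
    rw [ContinuousLinearMap.norm_id]
    have : 1 - h * ‖A‖ ≤ minNorm (ContinuousLinearMap.id ℝ V + h • A) := by
      refine le_csInf (hne.image _) ?_
      rintro _ ⟨z, hz, rfl⟩
      have hz' : ‖z‖ = 1 := by simpa using hz
      have h1 := norm_sub_le (z + h • A z) (h • A z)
      rw [add_sub_cancel_right, norm_smul, Real.norm_of_nonneg hh'.le, hz'] at h1
      have h2 := A.le_opNorm z
      rw [hz', mul_one] at h2
      change _ ≤ ‖z + h • A z‖
      nlinarith
    linarith

theorem logMin_le_inner_map {V : Type*} [NormedAddCommGroup V] [InnerProductSpace ℝ V]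
    (A : V →L[ℝ] V) (z : V) : logMin A * ‖z‖ ^ 2 ≤ inner ℝ z (A z) := by
  rcases eq_or_ne z 0 with rfl | hz0
  · simp
  have hnt : Nontrivial V := ⟨z, 0, hz0⟩
  -- It suffices to treat unit vectors.
  have key : ∀ z : V, ‖z‖ = 1 → logMin A ≤ inner ℝ z (A z) := by
    intro z hz
    have hlim : Tendsto (fun h : ℝ => inner ℝ z (A z) + h * ‖A z‖ ^ 2 / 2) (𝓝[>] 0)
        (𝓝 (inner ℝ z (A z))) := by
      have hcont : Continuous fun h : ℝ => inner ℝ z (A z) + h * ‖A z‖ ^ 2 / 2 := by fun_prop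
      simpa using (hcont.tendsto 0).mono_left nhdsWithin_le_nhds
    refine le_of_tendsto_of_tendsto (tendsto_logMin A) hlim ?_
    filter_upwards [self_mem_nhdsWithin] with h hh
    have hh' : (0 : ℝ) < h := hh
    rw [ContinuousLinearMap.norm_id, div_le_iff₀ hh']
    have hm : minNorm (ContinuousLinearMap.id ℝ V + h • A) ≤ ‖z + h • A z‖ :=
      csInf_le ⟨0, by rintro _ ⟨y, _, rfl⟩; exact norm_nonneg _⟩ ⟨z, by simpa using hz, rfl⟩
    have h4 : ‖z + h • A z‖ ^ 2 = 1 + 2 * (h * inner ℝ z (A z)) + h ^ 2 * ‖A z‖ ^ 2 := by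
      rw [norm_add_sq_real, hz, real_inner_smul_right, norm_smul, mul_pow, Real.norm_eq_abs,
        sq_abs]
      ring
    nlinarith [sq_nonneg (‖z + h • A z‖ - 1)]
  have hn : ‖z‖ ≠ 0 := norm_ne_zero_iff.2 hz0
  have h1 := key (‖z‖⁻¹ • z) (by rw [norm_smul, norm_inv, norm_norm, inv_mul_cancel₀ hn])
  rw [map_smul, real_inner_smul_left, real_inner_smul_right, ← mul_assoc] at h1
  have h2 := mul_le_mul_of_nonneg_right h1 (sq_nonneg ‖z‖)
  have h3 : ‖z‖⁻¹ * ‖z‖⁻¹ * inner ℝ z (A z) * ‖z‖ ^ 2 = inner ℝ z (A z) := by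
    field_simp
  linarith

/-! ### From local to global quadratic estimates on segments -/

/-- A function on `[0, 1]` that lies locally above a line through each point of its graph lies
globally above the line at `0`. -/
theorem add_slope_le_of_local_support {g p : ℝ → ℝ} (hg : ContinuousOn g (Icc 0 1))
    (hp : ∀ t ∈ Icc (0 : ℝ) 1, ∀ᶠ r in 𝓝[Icc 0 1] t, g t + p t * (r - t) ≤ g r) :
    g 0 + p 0 ≤ g 1 := by
  by_contra! hlt
  set c := g 1 - g 0 with hc
  set k : ℝ → ℝ := fun t => g t - g 0 - c * t with hk
  have hkc : ContinuousOn k (Icc 0 1) := by fun_prop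
  have hk' : ∀ t ∈ Icc (0 : ℝ) 1, ∀ᶠ r in 𝓝[Icc 0 1] t, k t + (p t - c) * (r - t) ≤ k r := by
    intro t ht
    filter_upwards [hp t ht] with r hr
    simp only [hk]
    linarith
  have right : ∀ t ∈ Ico (0 : ℝ) 1,
      ∃ r ∈ Icc (0 : ℝ) 1, t < r ∧ k t + (p t - c) * (r - t) ≤ k r := by
    intro t ht
    have h1 : ∀ᶠ r in 𝓝[>] t, r ∈ Icc (0 : ℝ) 1 :=
      nhdsWithin_mono _ Ioi_subset_Ici_self (Icc_mem_nhdsGE_of_mem ht)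
    have h2 : 𝓝[>] t ≤ 𝓝[Icc 0 1] t := le_inf (nhdsWithin_le_nhds) (le_principal_iff.2 h1)
    obtain ⟨r, hr1, hr2, hr3⟩ :=
      (h1.and ((eventually_mem_nhdsWithin).and (h2 (hk' t ⟨ht.1, ht.2.le⟩)))).exists
    exact ⟨r, hr1, hr2, hr3⟩
  have left : ∀ t ∈ Ioc (0 : ℝ) 1,
      ∃ r ∈ Icc (0 : ℝ) 1, r < t ∧ k t + (p t - c) * (r - t) ≤ k r := by
    intro t ht
    have h1 : ∀ᶠ r in 𝓝[<] t, r ∈ Icc (0 : ℝ) 1 :=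
      nhdsWithin_mono _ Iio_subset_Iic_self (Icc_mem_nhdsLE_of_mem ht)
    have h2 : 𝓝[<] t ≤ 𝓝[Icc 0 1] t := le_inf (nhdsWithin_le_nhds) (le_principal_iff.2 h1)
    obtain ⟨r, hr1, hr2, hr3⟩ :=
      (h1.and ((eventually_mem_nhdsWithin).and (h2 (hk' t ⟨ht.1.le, ht.2⟩)))).exists
    exact ⟨r, hr1, hr2, hr3⟩
  have hk0 : k 0 = 0 := by simp [hk]
  have hk1 : k 1 = 0 := by simp [hk, hc]
  obtain ⟨r₀, hr₀, hr₀0, hr₀k⟩ := right 0 (by simp)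
  have hpos : 0 < k r₀ := by
    rw [hk0] at hr₀k
    nlinarith [mul_pos (show 0 < p 0 - c by linarith) (show 0 < r₀ - 0 by linarith)]
  obtain ⟨m, hm, hmax⟩ := isCompact_Icc.exists_isMaxOn ⟨r₀, hr₀⟩ hkc
  -- The largest maximum point is interior, and a line through it cannot support the graph.
  obtain ⟨t, ⟨ht, htm⟩, htg⟩ := (isCompact_Icc.of_isClosed_subset
    (hkc.preimage_isClosed_of_isClosed isClosed_Icc (isClosed_singleton (x := k m)))
    inter_subset_left).exists_isGreatest ⟨m, hm, rfl⟩
  have htm' : k t = k m := htm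
  have hm0 : 0 < k m := hpos.trans_le (hmax hr₀)
  have ht0 : t ≠ 0 := by rintro rfl; linarith
  have ht1 : t ≠ 1 := by rintro rfl; linarith
  obtain ⟨a, ha, hta, hak⟩ := right t ⟨ht.1, lt_of_le_of_ne ht.2 ht1⟩
  obtain ⟨b, hb, hbt, hbk⟩ := left t ⟨lt_of_le_of_ne ht.1 ht0.symm, ht.2⟩
  have ha1 : k a < k m := lt_of_le_of_ne (hmax ha) fun h => absurd (htg ⟨ha, h⟩) (not_le.2 hta)
  have hb1 : k b ≤ k m := hmax hb
  have hs : p t - c < 0 := by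
    by_contra! h
    nlinarith [mul_nonneg h (sub_nonneg.2 hta.le)]
  nlinarith [mul_pos (neg_pos.2 hs) (sub_pos.2 hbt)]

/-- A first-order Taylor estimate with quadratic remainder that holds locally around each point of
`[0, 1]`, on neighbourhoods of uncontrolled size, holds from `0` to `1` with the same constant. -/
theorem norm_taylor_le_of_local {F : Type*} [NormedAddCommGroup F] [InnerProductSpace ℝ F]
    {φ φ' : ℝ → F} {c : ℝ} (hc : 0 ≤ c)
    (h : ∀ t ∈ Icc (0 : ℝ) 1, ∀ᶠ r in 𝓝[Icc 0 1] t,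
      ‖φ r - φ t - (r - t) • φ' t‖ ≤ c * (r - t) ^ 2) :
    ‖φ 1 - φ 0 - φ' 0‖ ≤ c := by
  have hφ : ContinuousOn φ (Icc 0 1) := by
    intro t ht
    have h0 : Tendsto (fun r => φ r - φ t - (r - t) • φ' t) (𝓝[Icc 0 1] t) (𝓝 0) := by
      refine squeeze_zero_norm' (h t ht) ?_
      have : Continuous fun r : ℝ => c * (r - t) ^ 2 := by fun_prop
      simpa using (this.tendsto t).mono_left nhdsWithin_le_nhds
    have h1 : Tendsto (fun r => φ t + (r - t) • φ' t) (𝓝[Icc 0 1] t) (𝓝 (φ t)) := by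
      have : Continuous fun r : ℝ => φ t + (r - t) • φ' t := by fun_prop
      simpa using (this.tendsto t).mono_left nhdsWithin_le_nhds
    have h2 := h0.add h1
    rw [zero_add] at h2
    refine h2.congr fun r => ?_
    abel
  set R := φ 1 - φ 0 - φ' 0 with hR
  have key := add_slope_le_of_local_support
    (g := fun t => c * ‖R‖ * t ^ 2 - inner ℝ R (φ t))
    (p := fun t => 2 * c * ‖R‖ * t - inner ℝ R (φ' t))
    (by fun_prop) (by
      intro t ht
      filter_upwards [h t ht] with r hr
      have h1 := real_inner_le_norm R (φ r - φ t - (r - t) • φ' t)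
      have h2 := mul_le_mul_of_nonneg_left hr (norm_nonneg R)
      rw [inner_sub_right, inner_sub_right, real_inner_smul_right] at h1
      nlinarith)
  have h3 : inner ℝ R (φ 1) - inner ℝ R (φ 0) - inner ℝ R (φ' 0) = ‖R‖ * ‖R‖ := by
    rw [← inner_sub_right, ← inner_sub_right, ← hR, real_inner_self_eq_norm_mul_norm]
  have h4 : ‖R‖ * ‖R‖ ≤ c * ‖R‖ := by
    nlinarith
  rcases (norm_nonneg R).eq_or_lt with h5 | h5
  · rw [← h5]; exact hc
  · exact le_of_mul_le_mul_right h4 h5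

/-- On a convex set with interior points, a quadratic bound on the first-order Taylor remainder,
uniform in the base point, passes to the second derivative at any point of the set, in all
directions. The remainder is evaluated at base points `x + h • a` with `a` pointing into the
interior, since a given direction need not point into the set at `x` itself. -/
theorem norm_second_fderivWithin_le {E F : Type*} [NormedAddCommGroup E] [NormedSpace ℝ E]
    [NormedAddCommGroup F] [NormedSpace ℝ F] {w : E → F} {K : Set E} {M : ℝ}
    (hK : Convex ℝ K) (hKint : (interior K).Nonempty)
    (hd : ∀ x ∈ K, DifferentiableWithinAt ℝ w K x)
    (hM : ∀ x ∈ K, ∀ v, x + v ∈ K → ‖w (x + v) - w x - fderivWithin ℝ w K x v‖ ≤ M * ‖v‖ ^ 2)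
    {x : E} (hx : x ∈ K) (h2 : DifferentiableWithinAt ℝ (fderivWithin ℝ w K) K x) (v : E) :
    ‖(1 / 2 : ℝ) • fderivWithin ℝ (fderivWithin ℝ w K) K x v v‖ ≤ M * ‖v‖ ^ 2 := by
  set w' := fderivWithin ℝ w K with hw'
  set Q := fderivWithin ℝ w' K x with hQ
  obtain ⟨p, hp⟩ := hKint
  set a := p - x with ha
  -- First the case in which `v` is short enough for `x + a + v` to remain in the interior.
  have small : ∀ v : E, x + a + v ∈ interior K → ‖(1 / 2 : ℝ) • Q v v‖ ≤ M * ‖v‖ ^ 2 := by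
    intro v hv
    have hxa : x + a ∈ interior K := by simpa [ha] using hp
    have T := hK.taylor_approx_two_segment (f := w) (f' := w') (f'' := Q)
      (fun y hy => ((hd y (interior_subset hy)).hasFDerivWithinAt).hasFDerivAt
        (mem_interior_iff_mem_nhds.1 hy)) hx
      (h2.hasFDerivWithinAt.mono interior_subset) hxa hv
    have hseg : ∀ y ∈ K, ∀ h : ℝ, 0 < h → h ≤ 1 → x + h • (y - x) ∈ K := fun y hy h h0 h1 =>
      hK.add_smul_sub_mem hx hy ⟨h0.le, h1⟩
    have hIoc : ∀ᶠ h : ℝ in 𝓝[>] 0, h ∈ Ioc (0 : ℝ) 1 := Ioc_mem_nhdsGT one_pos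
    have D : (fun h : ℝ => w' (x + h • a) v - w' x v - h • Q a v) =o[𝓝[>] 0] fun h => h := by
      have t1 : Tendsto (fun h : ℝ => x + h • a) (𝓝[>] 0) (𝓝[K] x) := by
        refine tendsto_nhdsWithin_iff.2 ⟨?_, ?_⟩
        · have : Continuous fun h : ℝ => x + h • a := by fun_prop
          simpa using (this.tendsto 0).mono_left nhdsWithin_le_nhds
        · filter_upwards [hIoc] with h hh
          exact hseg p (interior_subset hp) h hh.1 hh.2
      have t2 := (hasFDerivWithinAt_iff_isLittleO.1 h2.hasFDerivWithinAt).comp_tendsto t1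
      have t3 : (fun h : ℝ => w' (x + h • a) - w' x - h • Q a) =o[𝓝[>] 0] fun h => h := by
        refine (t2.congr_left fun h => ?_).trans_isBigO ?_
        · simp [hQ]
        · refine Asymptotics.IsBigO.of_bound ‖a‖ (Eventually.of_forall fun h => ?_)
          simp [norm_smul, mul_comm]
      have t4 : (fun h : ℝ => (w' (x + h • a) - w' x - h • Q a) v) =O[𝓝[>] 0]
          fun h : ℝ => w' (x + h • a) - w' x - h • Q a :=
        Asymptotics.IsBigO.of_bound ‖v‖ (Eventually.of_forall fun h => by
          rw [mul_comm]; exact ContinuousLinearMap.le_opNorm _ _)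
      simpa using t4.trans_isLittleO t3
    have D2 : (fun h : ℝ => h • (w' (x + h • a) v - w' x v - h • Q a v)) =o[𝓝[>] 0]
        fun h => h ^ 2 := by
      simpa [pow_two] using (Asymptotics.isBigO_refl (fun h : ℝ => h) (𝓝[>] 0)).smul_isLittleO D
    have S := T.sub D2
    refine le_of_forall_pos_le_add fun ε hε => ?_
    obtain ⟨h, ⟨h0, h1⟩, hS⟩ := (hIoc.and (S.def hε)).exists
    have m1 : x + h • a ∈ K := hseg p (interior_subset hp) h h0 h1
    have m2 : x + h • a + h • v ∈ K := by
      have := hseg _ (interior_subset hv) h h0 h1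
      rwa [show x + a + v - x = a + v by abel, smul_add, ← add_assoc] at this
    have h3 := hM _ m1 (h • v) m2
    set A := w (x + h • a + h • v) - w (x + h • a) - w' (x + h • a) (h • v) with hA
    have e : w (x + h • a + h • v) - w (x + h • a) - h • w' x v - h ^ 2 • Q a v
        - (h ^ 2 / 2) • Q v v - h • (w' (x + h • a) v - w' x v - h • Q a v)
        = A - h ^ 2 • ((1 / 2 : ℝ) • Q v v) := by
      rw [hA, map_smul]
      module
    rw [e, Real.norm_of_nonneg (sq_nonneg h)] at hS
    have h4 : ‖h ^ 2 • ((1 / 2 : ℝ) • Q v v)‖ ≤ ‖A‖ + ε * h ^ 2 := by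
      have := norm_sub_le A (A - h ^ 2 • ((1 / 2 : ℝ) • Q v v))
      rw [sub_sub_cancel] at this
      linarith
    rw [norm_smul (h ^ 2), Real.norm_of_nonneg (sq_nonneg h)] at h4
    rw [norm_smul, Real.norm_of_nonneg h0.le, mul_pow] at h3
    have h5 : 0 < h ^ 2 := by positivity
    refine le_of_mul_le_mul_left ?_ h5
    linarith
  have hev : ∀ᶠ t : ℝ in 𝓝[>] 0, x + a + t • v ∈ interior K := by
    have hc : Continuous fun t : ℝ => x + a + t • v := by fun_prop
    have : ∀ᶠ t : ℝ in 𝓝 0, x + a + t • v ∈ interior K :=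
      hc.continuousAt.eventually (isOpen_interior.mem_nhds (by simpa [ha] using hp))
    exact nhdsWithin_le_nhds this
  obtain ⟨t, ht, ht0⟩ := (hev.and self_mem_nhdsWithin).exists
  have ht0' : (0 : ℝ) < t := ht0
  have h3 := small (t • v) ht
  have e : (1 / 2 : ℝ) • Q (t • v) (t • v) = t ^ 2 • ((1 / 2 : ℝ) • Q v v) := by
    simp only [map_smul, smul_apply]
    module
  rw [e, norm_smul (t ^ 2), Real.norm_of_nonneg (sq_nonneg t), norm_smul t,
    Real.norm_of_nonneg ht0'.le, mul_pow] at h3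
  have h5 : 0 < t ^ 2 := by positivity
  refine le_of_mul_le_mul_left ?_ h5
  linarith

/-! ### Second-order Taylor expansion, uniformly on compact sets -/

theorem exists_uniform_taylor_two {E F : Type*} [NormedAddCommGroup E] [NormedSpace ℝ E]
    [NormedAddCommGroup F] [NormedSpace ℝ F] {f : E → F} {C : Set E} (hC : IsCompact C)
    (hf : ∀ z ∈ C, ContDiffAt ℝ 2 f z) {ε : ℝ} (hε : 0 < ε) :
    ∃ ρ > 0, ∀ z ∈ C, ∀ d : E, ‖d‖ ≤ ρ →
      ‖f (z + d) - f z - fderiv ℝ f z d - (1 / 2 : ℝ) • fderiv ℝ (fderiv ℝ f) z d d‖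
        ≤ ε * ‖d‖ ^ 2 := by
  refine hC.induction_on (p := fun s => ∃ ρ > 0, ∀ z ∈ s, ∀ d : E, ‖d‖ ≤ ρ →
      ‖f (z + d) - f z - fderiv ℝ f z d - (1 / 2 : ℝ) • fderiv ℝ (fderiv ℝ f) z d d‖
        ≤ ε * ‖d‖ ^ 2) ⟨1, one_pos, by simp⟩ ?_ ?_ ?_
  · rintro s t hst ⟨ρ, hρ, h⟩
    exact ⟨ρ, hρ, fun z hz => h z (hst hz)⟩
  · rintro s t ⟨ρ, hρ, h⟩ ⟨ρ', hρ', h'⟩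
    refine ⟨min ρ ρ', lt_min hρ hρ', ?_⟩
    rintro z (hz | hz) d hd
    · exact h z hz d (hd.trans (min_le_left _ _))
    · exact h' z hz d (hd.trans (min_le_right _ _))
  intro z₀ hz₀
  have hd2 : ContinuousAt (fderiv ℝ (fderiv ℝ f)) z₀ := by
    have h1 : ContDiffAt ℝ 1 (fderiv ℝ f) z₀ := (hf z₀ hz₀).fderiv_right (by norm_num)
    have h2 : ContDiffAt ℝ 0 (fderiv ℝ (fderiv ℝ f)) z₀ := h1.fderiv_right (by norm_num)
    exact h2.continuousAt
  have hev : ∀ᶠ z in 𝓝 z₀, ContDiffAt ℝ 2 f z ∧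
      dist (fderiv ℝ (fderiv ℝ f) z) (fderiv ℝ (fderiv ℝ f) z₀) < ε / 2 :=
    ((hf z₀ hz₀).eventually (by simp)).and
      (Metric.continuousAt_iff'.1 hd2 _ (half_pos hε))
  obtain ⟨r, hr, hball⟩ := Metric.eventually_nhds_iff_ball.1 hev
  refine ⟨Metric.ball z₀ (r / 2), mem_nhdsWithin_of_mem_nhds (Metric.ball_mem_nhds _ (half_pos hr)),
    r / 4, by positivity, ?_⟩
  intro z hz d hd
  set s := Metric.closedBall z ‖d‖ with hs
  have hsub : ∀ y ∈ s, y ∈ Metric.ball z₀ r := by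
    intro y hy
    have h1 : dist y z ≤ ‖d‖ := hy
    have h2 : dist z z₀ < r / 2 := hz
    have := dist_triangle y z z₀
    exact Metric.mem_ball.2 (by linarith)
  have hzs : z ∈ s := Metric.mem_closedBall_self (norm_nonneg _)
  have hconv : Convex ℝ s := convex_closedBall _ _
  set H := fderiv ℝ (fderiv ℝ f) z with hH
  have hzr := hball z (hsub z hzs)
  have hdiff : ∀ y ∈ s, HasFDerivAt f (fderiv ℝ f y) y := fun y hy =>
    ((hball y (hsub y hy)).1.differentiableAt (by norm_num)).hasFDerivAt
  have hdiff2 : ∀ y ∈ s, HasFDerivAt (fderiv ℝ f) (fderiv ℝ (fderiv ℝ f) y) y := fun y hy =>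
    (((hball y (hsub y hy)).1.fderiv_right (m := 1) (by norm_num)).differentiableAt
      (by norm_num)).hasFDerivAt
  -- First the expansion of the derivative, by the mean value inequality.
  have step1 : ∀ y ∈ s, ‖fderiv ℝ f y - fderiv ℝ f z - H (y - z)‖ ≤ ε * ‖y - z‖ := by
    intro y hy
    have := hconv.norm_image_sub_le_of_norm_hasFDerivWithin_le (C := ε)
      (f := fun y => fderiv ℝ f y - H y)
      (fun y hy => ((hdiff2 y hy).sub H.hasFDerivAt).hasFDerivWithinAt) (by
        intro y hy
        have h1 := (hball y (hsub y hy)).2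
        have h2 := hzr.2
        rw [← dist_eq_norm]
        have := dist_triangle_right (fderiv ℝ (fderiv ℝ f) y) H (fderiv ℝ (fderiv ℝ f) z₀)
        linarith) hzs hy
    have e : fderiv ℝ f y - fderiv ℝ f z - H (y - z)
        = fderiv ℝ f y - H y - (fderiv ℝ f z - H z) := by
      rw [map_sub]
      abel
    rw [e]
    exact this
  have hsymm : ∀ v w, H v w = H w v :=
    hzr.1.isSymmSndFDerivAt (by simp)
  have hder : ∀ y ∈ s, HasFDerivWithinAt
      (fun y => f y - fderiv ℝ f z (y - z) - (1 / 2 : ℝ) • H (y - z) (y - z))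
      (fderiv ℝ f y - fderiv ℝ f z - H (y - z)) s y := by
    intro y hy
    have hy1 : HasFDerivAt (fun y : E => y - z) (ContinuousLinearMap.id ℝ E) y :=
      (hasFDerivAt_id y).sub_const z
    have h1 : HasFDerivAt (fun y => fderiv ℝ f z (y - z)) (fderiv ℝ f z) y := by
      exact (fderiv ℝ f z).hasFDerivAt.comp y hy1
    have h2 : HasFDerivAt (fun y => H (y - z) (y - z)) ((2 : ℝ) • H (y - z)) y := by
      have h3 := (H.hasFDerivAt.comp y hy1).clm_apply hy1
      refine h3.congr_fderiv ?_
      ext v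
      simp [two_smul, hsymm v]
    have h4 := ((hdiff y hy).sub h1).sub (h2.const_smul (1 / 2 : ℝ))
    refine (h4.congr_fderiv ?_).hasFDerivWithinAt
    rw [smul_smul]
    norm_num
  have hzd : z + d ∈ s := by simp [hs]
  have := hconv.norm_image_sub_le_of_norm_hasFDerivWithin_le (C := ε * ‖d‖) hder (by
    intro y hy
    refine (step1 y hy).trans (mul_le_mul_of_nonneg_left ?_ hε.le)
    rw [← dist_eq_norm]
    exact hy) hzs hzd
  simp only [add_sub_cancel_left, sub_self, map_zero, smul_zero, sub_zero] at this
  calc _ = ‖f (z + d) - fderiv ℝ f z d - (1 / 2 : ℝ) • H d d - f z‖ := by congr 1; abel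
    _ ≤ _ := this
    _ = ε * ‖d‖ ^ 2 := by ring

/-! ### Differential inequalities -/

section Fences

variable {E F : Type*} [NormedAddCommGroup E] [InnerProductSpace ℝ E]
  [NormedAddCommGroup F] [InnerProductSpace ℝ F] {T : ℝ}

theorem hasDerivWithinAt_Ici_of_Icc {G : Type*} [NormedAddCommGroup G] [NormedSpace ℝ G]
    {g : ℝ → G} {g' : G} {t : ℝ} (h : HasDerivWithinAt g g' (Icc 0 T) t) (ht : t ∈ Ico 0 T) :
    HasDerivWithinAt g g' (Ici t) t :=
  h.mono_of_mem_nhdsWithin (Icc_mem_nhdsGE_of_mem ht)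

/-- The parabolic region `‖e‖ ≤ M ‖a‖²` is positively invariant. The fence is the boundary of the
slightly larger region `‖e‖ ≤ M ‖a‖² + η exp (c t)`, on which the inequalities are strict even where
`a` vanishes. -/
theorem norm_le_mul_sq_of_deriv_bounds {a a' : ℝ → E} {e e' : ℝ → F} {M μ ξ Γ ε : ℝ}
    (ha : ∀ t ∈ Icc 0 T, HasDerivWithinAt a (a' t) (Icc 0 T) t)
    (he : ∀ t ∈ Icc 0 T, HasDerivWithinAt e (e' t) (Icc 0 T) t)
    (h1 : ∀ t ∈ Icc 0 T, inner ℝ (e t) (e' t) ≤ ‖e t‖ * (μ * ‖e t‖ + Γ * ‖a t‖ ^ 2))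
    (h2 : ∀ t ∈ Icc 0 T, ξ * ‖a t‖ ^ 2 - ε * ‖e t‖ ≤ inner ℝ (a t) (a' t))
    (hM : 0 ≤ M) (hgap : μ * M + Γ + 2 * M ^ 2 * ε ≤ 2 * M * ξ)
    (h0 : ‖e 0‖ ≤ M * ‖a 0‖ ^ 2) {t : ℝ} (ht : t ∈ Icc 0 T) :
    ‖e t‖ ≤ M * ‖a t‖ ^ 2 := by
  set c := |μ| + 2 * M * ε + 1 with hc
  have key : ∀ η : ℝ, 0 < η → ‖e t‖ ≤ M * ‖a t‖ ^ 2 + η * Real.exp (c * t) := by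
    intro η hη
    have hpos : ∀ t, 0 < M * ‖a t‖ ^ 2 + η * Real.exp (c * t) := fun t => by positivity
    have hBd : ∀ t ∈ Icc 0 T, HasDerivWithinAt
        (fun t => (M * ‖a t‖ ^ 2 + η * Real.exp (c * t)) ^ 2)
        (2 * (M * ‖a t‖ ^ 2 + η * Real.exp (c * t)) *
          (M * (2 * inner ℝ (a t) (a' t)) + η * (Real.exp (c * t) * c))) (Icc 0 T) t := by
      intro t ht
      have e1 : HasDerivWithinAt (fun t => Real.exp (c * t)) (Real.exp (c * t) * c)
          (Icc 0 T) t := by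
        simpa using (((hasDerivAt_id t).const_mul c).exp).hasDerivWithinAt
      have := (((ha t ht).norm_sq.const_mul M).add (e1.const_mul η)).pow 2
      refine this.congr_deriv ?_
      simp
    have hfd : ∀ t ∈ Icc 0 T, HasDerivWithinAt (fun t => ‖e t‖ ^ 2)
        (2 * inner ℝ (e t) (e' t)) (Icc 0 T) t := fun t ht => (he t ht).norm_sq
    have := image_le_of_deriv_right_lt_deriv_boundary'
      (fun t ht => (hfd t ht).continuousWithinAt)
      (fun t ht => hasDerivWithinAt_Ici_of_Icc (hfd t (Ico_subset_Icc_self ht)) ht)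
      (by
        have : ‖e 0‖ ≤ M * ‖a 0‖ ^ 2 + η * Real.exp (c * 0) := by
          have : 0 < η * Real.exp (c * 0) := by positivity
          linarith
        exact pow_le_pow_left₀ (norm_nonneg _) this 2)
      (fun t ht => (hBd t ht).continuousWithinAt)
      (fun t ht => hasDerivWithinAt_Ici_of_Icc (hBd t (Ico_subset_Icc_self ht)) ht)
      (by
        intro t ht heq
        have ht' := Ico_subset_Icc_self ht
        have hq := hpos t
        have heq' : ‖e t‖ = M * ‖a t‖ ^ 2 + η * Real.exp (c * t) :=
          (pow_left_inj₀ (norm_nonneg _) hq.le two_ne_zero).1 heq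
        have i1 := h1 t ht'
        have i2 := h2 t ht'
        set q := M * ‖a t‖ ^ 2 + η * Real.exp (c * t) with hqdef
        set p := η * Real.exp (c * t) with hp
        have hp0 : 0 < p := by positivity
        rw [heq'] at i1 i2
        have hmain : μ * q + Γ * ‖a t‖ ^ 2 < M * (2 * inner ℝ (a t) (a' t)) + c * p := by
          have j1 : M * (2 * (ξ * ‖a t‖ ^ 2 - ε * q)) ≤ M * (2 * inner ℝ (a t) (a' t)) :=
            mul_le_mul_of_nonneg_left (by linarith) hM
          have j2 : μ * p ≤ |μ| * p := mul_le_mul_of_nonneg_right (le_abs_self μ) hp0.le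
          have j3 := mul_le_mul_of_nonneg_right hgap (sq_nonneg ‖a t‖)
          have j4 : c * p = |μ| * p + 2 * M * ε * p + p := by rw [hc]; ring
          rw [hqdef] at j1 ⊢
          nlinarith
        have := mul_lt_mul_of_pos_left hmain hq
        calc 2 * inner ℝ (e t) (e' t) ≤ 2 * (q * (μ * q + Γ * ‖a t‖ ^ 2)) := by linarith
          _ < 2 * (q * (M * (2 * inner ℝ (a t) (a' t)) + c * p)) := by linarith
          _ = _ := by rw [hp]; ring) ht
    exact (pow_le_pow_iff_left₀ (norm_nonneg _) (hpos t).le two_ne_zero).1 this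
  refine le_of_forall_pos_le_add fun η hη => ?_
  have := key (η / Real.exp (c * t)) (by positivity)
  rwa [div_mul_cancel₀ _ (Real.exp_pos _).ne'] at this

/-- A Grönwall estimate whose hypothesis is only available while the curve is in the ball of
radius `ρ`, and which keeps the curve in this ball. -/
theorem norm_le_of_local_deriv_bound {d d' : ℝ → E} {K ρ : ℝ} (hK : 0 ≤ K) (hρ : 0 < ρ)
    (hd : ∀ t ∈ Icc 0 T, HasDerivWithinAt d (d' t) (Icc 0 T) t)
    (hb : ∀ t ∈ Icc 0 T, ‖d t‖ ≤ ρ → ‖d' t‖ ≤ K * ‖d t‖)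
    (h0 : ‖d 0‖ ≤ ρ * Real.exp (-((K + 1) * T))) {t : ℝ} (ht : t ∈ Icc 0 T) : ‖d t‖ ≤ ρ := by
  set B : ℝ → ℝ := fun t => (ρ * Real.exp ((K + 1) * (t - T))) ^ 2 with hB
  have hBle : ∀ t ∈ Icc 0 T, ρ * Real.exp ((K + 1) * (t - T)) ≤ ρ := by
    intro t ht
    have : Real.exp ((K + 1) * (t - T)) ≤ 1 :=
      Real.exp_le_one_iff.2 (mul_nonpos_of_nonneg_of_nonpos (by linarith) (by linarith [ht.2]))
    nlinarith
  have hBd : ∀ t, HasDerivAt B (2 * (K + 1) * B t) t := by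
    intro t
    have e1 : HasDerivAt (fun t => Real.exp ((K + 1) * (t - T)))
        (Real.exp ((K + 1) * (t - T)) * (K + 1)) t := by
      simpa using ((((hasDerivAt_id t).sub_const T).const_mul (K + 1)).exp)
    refine ((e1.const_mul ρ).pow 2).congr_deriv ?_
    simp [hB]
    ring
  have hfd : ∀ t ∈ Icc 0 T, HasDerivWithinAt (fun t => ‖d t‖ ^ 2)
      (2 * inner ℝ (d t) (d' t)) (Icc 0 T) t := fun t ht => (hd t ht).norm_sq
  have := image_le_of_deriv_right_lt_deriv_boundary
    (fun t ht => (hfd t ht).continuousWithinAt)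
    (fun t ht => hasDerivWithinAt_Ici_of_Icc (hfd t (Ico_subset_Icc_self ht)) ht)
    (B := B) (by
      refine pow_le_pow_left₀ (norm_nonneg _) ?_ 2
      rwa [zero_sub, mul_neg]) hBd (by
      intro t ht heq
      have ht' := Ico_subset_Icc_self ht
      have h1 : ‖d t‖ = ρ * Real.exp ((K + 1) * (t - T)) :=
        (pow_left_inj₀ (norm_nonneg _) (by positivity) two_ne_zero).1 heq
      have hpos : 0 < ‖d t‖ := by rw [h1]; positivity
      have h2 := hb t ht' (by rw [h1]; exact hBle t ht')
      have h3 := real_inner_le_norm (d t) (d' t)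
      rw [← heq]
      nlinarith [mul_le_mul_of_nonneg_left h2 hpos.le, pow_pos hpos 2]) ht
  exact ((pow_le_pow_iff_left₀ (norm_nonneg _) (by positivity) two_ne_zero).1 this).trans
    (hBle t ht)

end Fences

/-! ### The Riccati equation of the slopes -/

section Riccati

/-- The radial retraction onto the closed ball of radius `R` around the origin. -/
noncomputable def radialRetract {G : Type*} [NormedAddCommGroup G] [NormedSpace ℝ G] (R : ℝ)
    (S : G) : G := (R / max R ‖S‖) • S

section Retract

variable {G : Type*} [NormedAddCommGroup G] [NormedSpace ℝ G] {R : ℝ}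

theorem norm_radialRetract_le (hR : 0 < R) (S : G) : ‖radialRetract R S‖ ≤ R := by
  have hm : 0 < max R ‖S‖ := lt_max_of_lt_left hR
  rw [radialRetract, norm_smul, Real.norm_of_nonneg (by positivity), div_mul_eq_mul_div,
    div_le_iff₀ hm]
  exact mul_le_mul_of_nonneg_left (le_max_right _ _) hR.le

theorem radialRetract_eq_self (hR : 0 < R) {S : G} (hS : ‖S‖ ≤ R) : radialRetract R S = S := by
  rw [radialRetract, max_eq_left hS, div_self hR.ne', one_smul]

theorem norm_radialRetract_sub_le (hR : 0 < R) (S T : G) :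
    ‖radialRetract R S - radialRetract R T‖ ≤ 2 * ‖S - T‖ := by
  have hS : 0 < max R ‖S‖ := lt_max_of_lt_left hR
  have hT : 0 < max R ‖T‖ := lt_max_of_lt_left hR
  have e : radialRetract R S - radialRetract R T
      = (R / max R ‖S‖) • (S - T) + (R / max R ‖S‖ - R / max R ‖T‖) • T := by
    simp only [radialRetract]
    module
  have h1 : R / max R ‖S‖ ≤ 1 := (div_le_one hS).2 (le_max_left _ _)
  have h2 : |R / max R ‖S‖ - R / max R ‖T‖| * ‖T‖ ≤ ‖S - T‖ := by
    have e2 : R / max R ‖S‖ - R / max R ‖T‖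
        = (R / max R ‖S‖) * ((max R ‖T‖ - max R ‖S‖) / max R ‖T‖) := by
      field_simp
    have h3 : |max R ‖T‖ - max R ‖S‖| ≤ ‖S - T‖ := by
      rw [max_comm R, max_comm R]
      refine (abs_max_sub_max_le_abs _ _ _).trans ?_
      rw [norm_sub_rev]
      exact abs_norm_sub_norm_le T S
    rw [e2, abs_mul, abs_of_nonneg (by positivity), abs_div, abs_of_pos hT]
    have h4 : ‖T‖ / max R ‖T‖ ≤ 1 := (div_le_one hT).2 (le_max_right _ _)
    calc R / max R ‖S‖ * (|max R ‖T‖ - max R ‖S‖| / max R ‖T‖) * ‖T‖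
        = R / max R ‖S‖ * (‖T‖ / max R ‖T‖) * |max R ‖T‖ - max R ‖S‖| := by ring
      _ ≤ 1 * 1 * ‖S - T‖ := by gcongr
      _ = _ := by ring
  rw [e]
  refine (norm_add_le _ _).trans ?_
  rw [norm_smul, norm_smul, Real.norm_of_nonneg (by positivity), Real.norm_eq_abs]
  nlinarith [norm_nonneg (S - T)]

end Retract

/-- A bounded, uniformly Lipschitz time-dependent vector field has a solution on the whole of a
given time interval. -/
theorem exists_solution_of_bounded_lipschitz {G : Type*} [NormedAddCommGroup G] [NormedSpace ℝ G]
    [CompleteSpace G] {T : ℝ} (hT : 0 ≤ T) {Fd : ℝ → G → G} {N K : ℝ} (hN : 0 ≤ N) (hK : 0 ≤ K)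
    (hcont : ∀ S, ContinuousOn (fun t => Fd t S) (Icc 0 T))
    (hbd : ∀ t ∈ Icc 0 T, ∀ S, ‖Fd t S‖ ≤ N)
    (hlip : ∀ t ∈ Icc 0 T, ∀ S S', ‖Fd t S - Fd t S'‖ ≤ K * ‖S - S'‖) (S₀ : G) :
    ∃ S : ℝ → G, S 0 = S₀ ∧ ∀ t ∈ Icc 0 T, HasDerivWithinAt S (Fd t (S t)) (Icc 0 T) t := by
  have hPL : IsPicardLindelof Fd (⟨0, left_mem_Icc.2 hT⟩ : Icc (0 : ℝ) T) S₀
      ⟨N * T, by positivity⟩ 0 ⟨N, hN⟩ ⟨K, hK⟩ := by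
    refine ⟨fun t ht => ?_, fun S _ => hcont S, fun t ht S _ => hbd t ht S, ?_⟩
    · exact LipschitzOnWith.of_dist_le_mul fun S _ S' _ => by
        rw [dist_eq_norm, dist_eq_norm]
        exact hlip t ht S S'
    · simp only [sub_zero, sub_self, max_eq_left hT]
      exact le_of_eq (by simp; rfl)
  exact hPL.exists_eq_forall_mem_Icc_hasDerivWithinAt₀

variable {E F : Type*} [NormedAddCommGroup E] [InnerProductSpace ℝ E]
  [NormedAddCommGroup F] [InnerProductSpace ℝ F]

/-- The right-hand side `C + N S - S A - S B S` of the Riccati equation for the slope `S` of a graph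
moved by the linear flow with blocks `A`, `B`, `C`, `N`. -/
def riccati (A : E →L[ℝ] E) (B : F →L[ℝ] E) (C : E →L[ℝ] F) (N : F →L[ℝ] F) (S : E →L[ℝ] F) :
    E →L[ℝ] F :=
  C + N.comp S - S.comp (A + B.comp S)

theorem norm_riccati_le {A : E →L[ℝ] E} {B : F →L[ℝ] E} {C : E →L[ℝ] F} {N : F →L[ℝ] F}
    {S : E →L[ℝ] F} {b L : ℝ} (hA : ‖A‖ ≤ b) (hB : ‖B‖ ≤ b) (hC : ‖C‖ ≤ b) (hN : ‖N‖ ≤ b)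
    (hS : ‖S‖ ≤ L) : ‖riccati A B C N S‖ ≤ b + b * L + L * (b + b * L) := by
  have hb : 0 ≤ b := (norm_nonneg _).trans hA
  have hL : 0 ≤ L := (norm_nonneg _).trans hS
  calc ‖riccati A B C N S‖ ≤ ‖C‖ + ‖N‖ * ‖S‖ + ‖S‖ * (‖A‖ + ‖B‖ * ‖S‖) := by
        refine (norm_sub_le _ _).trans (add_le_add ((norm_add_le _ _).trans ?_) ?_)
        · exact add_le_add le_rfl (ContinuousLinearMap.opNorm_comp_le _ _)
        · refine (ContinuousLinearMap.opNorm_comp_le _ _).trans ?_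
          gcongr
          exact (norm_add_le _ _).trans (add_le_add le_rfl (ContinuousLinearMap.opNorm_comp_le _ _))
    _ ≤ _ := by gcongr

theorem norm_riccati_sub_le {A : E →L[ℝ] E} {B : F →L[ℝ] E} {C : E →L[ℝ] F} {N : F →L[ℝ] F}
    {S S' : E →L[ℝ] F} {b L : ℝ} (hA : ‖A‖ ≤ b) (hB : ‖B‖ ≤ b) (hN : ‖N‖ ≤ b)
    (hS : ‖S‖ ≤ L) (hS' : ‖S'‖ ≤ L) :
    ‖riccati A B C N S - riccati A B C N S'‖ ≤ (2 * b + 2 * b * L) * ‖S - S'‖ := by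
  have hb : 0 ≤ b := (norm_nonneg _).trans hA
  have hL : 0 ≤ L := (norm_nonneg _).trans hS
  have e : riccati A B C N S - riccati A B C N S' = N.comp (S - S') - (S - S').comp A
      - ((S - S').comp (B.comp S) + S'.comp (B.comp (S - S'))) := by
    ext v
    simp [riccati]
    abel
  rw [e]
  have h1 : ‖N.comp (S - S')‖ ≤ b * ‖S - S'‖ :=
    (ContinuousLinearMap.opNorm_comp_le _ _).trans (by gcongr)
  have h2 : ‖(S - S').comp A‖ ≤ ‖S - S'‖ * b :=
    (ContinuousLinearMap.opNorm_comp_le _ _).trans (by gcongr)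
  have h3 : ‖(S - S').comp (B.comp S)‖ ≤ ‖S - S'‖ * (b * L) :=
    (ContinuousLinearMap.opNorm_comp_le _ _).trans (by
      gcongr
      exact (ContinuousLinearMap.opNorm_comp_le _ _).trans (by gcongr))
  have h4 : ‖S'.comp (B.comp (S - S'))‖ ≤ L * (b * ‖S - S'‖) :=
    (ContinuousLinearMap.opNorm_comp_le _ _).trans (by
      gcongr
      exact (ContinuousLinearMap.opNorm_comp_le _ _).trans (by gcongr))
  have h5 := norm_sub_le (N.comp (S - S') - (S - S').comp A)
    ((S - S').comp (B.comp S) + S'.comp (B.comp (S - S')))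
  have h6 := norm_sub_le (N.comp (S - S')) ((S - S').comp A)
  have h7 := norm_add_le ((S - S').comp (B.comp S)) (S'.comp (B.comp (S - S')))
  linarith

theorem norm_id_add_smul_le {N : F →L[ℝ] F} {l τ : ℝ}
    (hN : ∀ b, inner ℝ b (N b) ≤ l * ‖b‖ ^ 2) (hτ : 0 ≤ τ) (hτl : -1 ≤ τ * l) :
    ‖ContinuousLinearMap.id ℝ F + τ • N‖ ≤ 1 + τ * l + τ ^ 2 * ‖N‖ ^ 2 / 2 := by
  have h0 : 0 ≤ 1 + τ * l + τ ^ 2 * ‖N‖ ^ 2 / 2 := by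
    have : 0 ≤ τ ^ 2 * ‖N‖ ^ 2 / 2 := by positivity
    linarith
  refine ContinuousLinearMap.opNorm_le_bound _ h0 fun b => ?_
  have h1 : ‖b + τ • N b‖ ^ 2 = ‖b‖ ^ 2 + 2 * (τ * inner ℝ b (N b)) + τ ^ 2 * ‖N b‖ ^ 2 := by
    rw [norm_add_sq_real, real_inner_smul_right, norm_smul, mul_pow, Real.norm_eq_abs, sq_abs]
  have h2 : ‖N b‖ ^ 2 ≤ (‖N‖ * ‖b‖) ^ 2 := pow_le_pow_left₀ (norm_nonneg _) (N.le_opNorm b) 2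
  have h3 := mul_le_mul_of_nonneg_left (hN b) hτ
  have h4 := mul_le_mul_of_nonneg_left h2 (sq_nonneg τ)
  have h5 : (‖b‖ * (1 + τ * l + τ ^ 2 * ‖N‖ ^ 2 / 2)) ^ 2
      = ‖b‖ ^ 2 * (1 + 2 * (τ * l) + τ ^ 2 * ‖N‖ ^ 2)
        + ‖b‖ ^ 2 * (τ * l + τ ^ 2 * ‖N‖ ^ 2 / 2) ^ 2 := by ring
  have h6 : 0 ≤ ‖b‖ ^ 2 * (τ * l + τ ^ 2 * ‖N‖ ^ 2 / 2) ^ 2 := by positivity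
  change ‖b + τ • N b‖ ≤ _
  rw [mul_comm]
  refine (pow_le_pow_iff_left₀ (norm_nonneg _) (by positivity) two_ne_zero).1 ?_
  rw [h1, h5]
  nlinarith

/-- Where `‖S‖ = L`, an Euler step of the Riccati equation shortens `S` to first order. -/
theorem norm_add_smul_riccati_le {A : E →L[ℝ] E} {B : F →L[ℝ] E} {C : E →L[ℝ] F} {N : F →L[ℝ] F}
    {S : E →L[ℝ] F} {L m β γ l : ℝ}
    (hA : ∀ a, m * ‖a‖ ^ 2 ≤ inner ℝ a (A a)) (hB : ‖B‖ ≤ β) (hC : ‖C‖ ≤ γ)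
    (hN : ∀ b, inner ℝ b (N b) ≤ l * ‖b‖ ^ 2) (hS : ‖S‖ = L) :
    ∃ q : ℝ → ℝ, Continuous q ∧ q 0 = l * L + γ - L * (m - L * β) ∧
      ∀ᶠ τ in 𝓝[>] (0 : ℝ), ‖S + τ • riccati A B C N S‖ ≤ L + τ * q τ := by
  have hL : 0 ≤ L := hS ▸ norm_nonneg S
  have hβ : 0 ≤ β := (norm_nonneg B).trans hB
  set G := A + B.comp S with hG
  set g := m - L * β with hg
  have hGm : ∀ a, inner ℝ a ((-G) a) ≤ (-g) * ‖a‖ ^ 2 := by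
    intro a
    have h1 := hA a
    have h2 : ‖B (S a)‖ ≤ β * (L * ‖a‖) :=
      (B.le_of_opNorm_le hB _).trans (mul_le_mul_of_nonneg_left (hS ▸ S.le_opNorm a) hβ)
    have h3 := (abs_le.1 (abs_real_inner_le_norm a (B (S a)))).1
    have h4 := mul_le_mul_of_nonneg_left h2 (norm_nonneg a)
    have h5 : inner ℝ a ((-G) a) = -(inner ℝ a (A a) + inner ℝ a (B (S a))) := by
      simp [hG, inner_add_right, inner_neg_right, -neg_add_rev]
    rw [h5, hg]
    nlinarith
  set x := ‖N‖ ^ 2 / 2 with hx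
  set y := ‖-G‖ ^ 2 / 2 with hy
  set k := ‖(N.comp S).comp G‖ with hk
  refine ⟨fun τ => (l - g + τ * (x + y - l * g) + τ ^ 2 * (l * y - x * g) + τ ^ 3 * (x * y)) * L
    + γ + τ * k, by fun_prop, by simp; ring, ?_⟩
  have small : ∀ c : ℝ, ∀ᶠ τ in 𝓝[>] (0 : ℝ), -1 ≤ τ * c := by
    intro c
    have hc : Continuous fun τ : ℝ => τ * c := by fun_prop
    have : ∀ᶠ τ in 𝓝 (0 : ℝ), -1 < τ * c :=
      hc.continuousAt.eventually (lt_mem_nhds (by norm_num))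
    exact nhdsWithin_le_nhds (this.mono fun _ h => h.le)
  filter_upwards [small l, small (-g), self_mem_nhdsWithin] with τ h1 h2 hτ
  have hτ' : (0 : ℝ) < τ := hτ
  have n1 := norm_id_add_smul_le hN hτ'.le h1
  have n2 := norm_id_add_smul_le hGm hτ'.le h2
  have e : S + τ • riccati A B C N S
      = (ContinuousLinearMap.id ℝ F + τ • N).comp (S.comp (ContinuousLinearMap.id ℝ E + τ • (-G)))
        + τ • C + τ ^ 2 • (N.comp S).comp G := by
    ext v
    simp [riccati, hG, smul_smul]
    module
  have b1 : ‖(ContinuousLinearMap.id ℝ F + τ • N).comp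
      (S.comp (ContinuousLinearMap.id ℝ E + τ • (-G)))‖
      ≤ (1 + τ * l + τ ^ 2 * ‖N‖ ^ 2 / 2) * (L * (1 + τ * (-g) + τ ^ 2 * ‖-G‖ ^ 2 / 2)) := by
    refine (ContinuousLinearMap.opNorm_comp_le _ _).trans ?_
    refine mul_le_mul n1 ?_ (norm_nonneg _) ((norm_nonneg _).trans n1)
    refine (ContinuousLinearMap.opNorm_comp_le _ _).trans ?_
    rw [hS]
    exact mul_le_mul_of_nonneg_left n2 hL
  have b2 : ‖τ • C‖ ≤ τ * γ := by
    rw [norm_smul, Real.norm_of_nonneg hτ'.le]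
    exact mul_le_mul_of_nonneg_left hC hτ'.le
  have b3 : ‖τ ^ 2 • (N.comp S).comp G‖ = τ ^ 2 * k := by
    rw [norm_smul, Real.norm_of_nonneg (sq_nonneg τ)]
  rw [e]
  refine (norm_add_le _ _).trans ?_
  have := norm_add_le ((ContinuousLinearMap.id ℝ F + τ • N).comp
    (S.comp (ContinuousLinearMap.id ℝ E + τ • (-G)))) (τ • C)
  rw [b3]
  have e2 : (1 + τ * l + τ ^ 2 * ‖N‖ ^ 2 / 2) * (L * (1 + τ * (-g) + τ ^ 2 * ‖-G‖ ^ 2 / 2))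
      + τ * γ + τ ^ 2 * k = L + τ * ((l - g + τ * (x + y - l * g) + τ ^ 2 * (l * y - x * g)
        + τ ^ 3 * (x * y)) * L + γ + τ * k) := by
    rw [hx, hy]
    ring
  linarith

/-- Under the cone condition `l L + γ < L (m - L β)` the Riccati equation has solutions on all of
`[0, T]` from any initial slope in the ball of radius `L`, and they stay in this ball. The equation
is first solved with its right-hand side precomposed with the retraction onto the ball; this
modification is invisible to the solution since the ball is invariant. -/
theorem exists_riccati_solution [CompleteSpace F] {T : ℝ} (hT : 0 ≤ T)
    {A : ℝ → E →L[ℝ] E} {B : ℝ → F →L[ℝ] E} {C : ℝ → E →L[ℝ] F} {N : ℝ → F →L[ℝ] F}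
    (hAc : ContinuousOn A (Icc 0 T)) (hBc : ContinuousOn B (Icc 0 T))
    (hCc : ContinuousOn C (Icc 0 T)) (hNc : ContinuousOn N (Icc 0 T))
    {L m β γ l b : ℝ} (hL : 0 < L) (hrate : l * L + γ < L * (m - L * β))
    (hA : ∀ t ∈ Icc 0 T, ∀ a, m * ‖a‖ ^ 2 ≤ inner ℝ a (A t a)) (hB : ∀ t ∈ Icc 0 T, ‖B t‖ ≤ β)
    (hC : ∀ t ∈ Icc 0 T, ‖C t‖ ≤ γ) (hN : ∀ t ∈ Icc 0 T, ∀ b, inner ℝ b (N t b) ≤ l * ‖b‖ ^ 2)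
    (hAb : ∀ t ∈ Icc 0 T, ‖A t‖ ≤ b) (hBb : ∀ t ∈ Icc 0 T, ‖B t‖ ≤ b)
    (hCb : ∀ t ∈ Icc 0 T, ‖C t‖ ≤ b) (hNb : ∀ t ∈ Icc 0 T, ‖N t‖ ≤ b)
    {S₀ : E →L[ℝ] F} (hS₀ : ‖S₀‖ ≤ L) :
    ∃ S : ℝ → E →L[ℝ] F, S 0 = S₀ ∧ ∀ t ∈ Icc 0 T, ‖S t‖ ≤ L ∧
      HasDerivWithinAt S (riccati (A t) (B t) (C t) (N t) (S t)) (Icc 0 T) t := by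
  have hb : 0 ≤ b := (norm_nonneg _).trans (hAb 0 (left_mem_Icc.2 hT))
  obtain ⟨S, hS0, hS⟩ := exists_solution_of_bounded_lipschitz hT
    (Fd := fun t S => riccati (A t) (B t) (C t) (N t) (radialRetract L S))
    (N := b + b * L + L * (b + b * L)) (K := (2 * b + 2 * b * L) * 2)
    (by positivity) (by positivity)
    (fun S => by
      simp only [riccati]
      exact (hCc.add (hNc.clm_comp continuousOn_const)).sub
        (continuousOn_const.clm_comp (hAc.add (hBc.clm_comp continuousOn_const))))
    (fun t ht S => norm_riccati_le (hAb t ht) (hBb t ht) (hCb t ht) (hNb t ht)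
      (norm_radialRetract_le hL S))
    (fun t ht S S' => by
      refine (norm_riccati_sub_le (hAb t ht) (hBb t ht) (hNb t ht) (norm_radialRetract_le hL S)
        (norm_radialRetract_le hL S')).trans ?_
      rw [mul_assoc (2 * b + 2 * b * L)]
      exact mul_le_mul_of_nonneg_left (norm_radialRetract_sub_le hL S S') (by positivity)) S₀
  have hSc : ContinuousOn (fun t => ‖S t‖) (Icc 0 T) :=
    (ContinuousOn.norm fun t ht => (hS t ht).continuousWithinAt)
  have hle : ∀ t ∈ Icc 0 T, ‖S t‖ ≤ L := by
    -- Off the sphere of radius `L` the growth rate of `‖S‖` plays no role in the fence.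
    have := image_le_of_liminf_slope_right_lt_deriv_boundary (f := fun t => ‖S t‖)
      (f' := fun t => if ‖S t‖ = L then l * L + γ - L * (m - L * β)
        else ‖riccati (A t) (B t) (C t) (N t) (radialRetract L (S t))‖) hSc (by
        intro t ht r hr
        have ht' := Ico_subset_Icc_self ht
        have hder := hasDerivWithinAt_Ici_of_Icc (hS t ht') ht
        by_cases hSt : ‖S t‖ = L
        · simp only [hSt, if_true] at hr
          rw [radialRetract_eq_self hL hSt.le] at hder
          obtain ⟨q, hqc, hq0, hq⟩ := norm_add_smul_riccati_le (hA t ht') (hB t ht') (hC t ht')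
            (hN t ht') hSt
          set Rc := riccati (A t) (B t) (C t) (N t) (S t) with hRc
          have htend := (hasDerivWithinAt_iff_tendsto_slope' (self_notMem_Ioi)).1
            hder.Ioi_of_Ici
          have hshift : Tendsto (fun z : ℝ => z - t) (𝓝[>] t) (𝓝[>] 0) := by
            refine tendsto_nhdsWithin_iff.2 ⟨?_, ?_⟩
            · have : Continuous fun z : ℝ => z - t := by fun_prop
              simpa using (this.tendsto t).mono_left nhdsWithin_le_nhds
            · filter_upwards [self_mem_nhdsWithin] with z hz
              exact sub_pos.2 (mem_Ioi.1 hz)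
          have hlim : Tendsto (fun z : ℝ => q (z - t) + ‖slope S t z - Rc‖) (𝓝[>] t)
              (𝓝 (l * L + γ - L * (m - L * β))) := by
            have h1 : Tendsto (fun z : ℝ => q (z - t)) (𝓝[>] t) (𝓝 (q 0)) :=
              (hqc.tendsto 0).comp (hshift.mono_right nhdsWithin_le_nhds)
            have h2 := (htend.sub_const Rc).norm
            rw [sub_self, norm_zero] at h2
            rw [← hq0]
            simpa using h1.add h2
          refine Eventually.frequently ?_
          filter_upwards [hlim.eventually (gt_mem_nhds hr), hshift.eventually hq,
            self_mem_nhdsWithin] with z hz1 hz2 hz3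
          have hzt : 0 < z - t := sub_pos.2 hz3
          refine lt_of_le_of_lt ?_ hz1
          rw [slope_def_field, div_le_iff₀ hzt]
          have e : S z = (S t + (z - t) • Rc) + (z - t) • (slope S t z - Rc) := by
            rw [slope_def_module, smul_sub, smul_inv_smul₀ hzt.ne']
            abel
          have h3 := norm_add_le (S t + (z - t) • Rc) ((z - t) • (slope S t z - Rc))
          rw [← e, norm_smul, Real.norm_of_nonneg hzt.le] at h3
          rw [hSt]
          linarith
        · simp only [hSt, if_false] at hr
          exact hder.liminf_right_slope_norm_le hr)
      (B := fun _ => L) (B' := fun _ => 0) (by rwa [hS0]) (fun t => hasDerivAt_const t L) (by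
        intro t _ heq
        simp only [heq, if_true]
        linarith)
    exact fun t ht => this ht
  refine ⟨S, hS0, fun t ht => ⟨hle t ht, ?_⟩⟩
  have := hS t ht
  rwa [radialRetract_eq_self hL (hle t ht)] at this

end Riccati

variable {u s : ℕ} {f : Phase u s → Phase u s} {D : Set (Phase u s)}

/-! ### Blocks of the derivatives of the vector field -/

theorem phase_ext {z w : Phase u s} (h₁ : z.fst = w.fst) (h₂ : z.snd = w.snd) : z = w :=
  WithLp.ofLp_injective 2 (Prod.ext h₁ h₂)

theorem eq_inX_add_inY (d : Phase u s) : d = inX u s d.fst + inY u s d.snd :=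
  phase_ext (by simp [inX_apply, inY_apply]) (by simp [inX_apply, inY_apply])

theorem hasFDerivAt_compX {z : Phase u s} (hf : DifferentiableAt ℝ f z) :
    HasFDerivAt (compX f) ((WithLp.fstL 2 ℝ _ _).comp (fderiv ℝ f z)) z :=
  (WithLp.fstL 2 ℝ _ _).hasFDerivAt.comp z hf.hasFDerivAt

theorem hasFDerivAt_compY {z : Phase u s} (hf : DifferentiableAt ℝ f z) :
    HasFDerivAt (compY f) ((WithLp.sndL 2 ℝ _ _).comp (fderiv ℝ f z)) z :=
  (WithLp.sndL 2 ℝ _ _).hasFDerivAt.comp z hf.hasFDerivAt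

theorem fderiv_apply_fst {z : Phase u s} (hf : DifferentiableAt ℝ f z) (d : Phase u s) :
    (fderiv ℝ f z d).fst = dXX f z d.fst + dXY f z d.snd := by
  have e := eq_inX_add_inY d
  rw [dXX, dXY, (hasFDerivAt_compX hf).fderiv]
  conv_lhs => rw [e, map_add]
  rfl

theorem fderiv_apply_snd {z : Phase u s} (hf : DifferentiableAt ℝ f z) (d : Phase u s) :
    (fderiv ℝ f z d).snd = dYX f z d.fst + dYY f z d.snd := by
  have e := eq_inX_add_inY d
  rw [dYX, dYY, (hasFDerivAt_compY hf).fderiv]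
  conv_lhs => rw [e, map_add]
  rfl

theorem norm_pt_zero_right (x : EuclideanSpace ℝ (Fin u)) : ‖(pt x 0 : Phase u s)‖ = ‖x‖ := by
  exact (pow_left_inj₀ (norm_nonneg _) (norm_nonneg _) two_ne_zero).1 (by simp)

theorem norm_pt_zero_left (y : EuclideanSpace ℝ (Fin s)) : ‖(pt 0 y : Phase u s)‖ = ‖y‖ := by
  exact (pow_left_inj₀ (norm_nonneg _) (norm_nonneg _) two_ne_zero).1 (by simp)

theorem norm_le_norm_fst_add_norm_snd (z : Phase u s) : ‖z‖ ≤ ‖z.fst‖ + ‖z.snd‖ := by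
  have := WithLp.prod_norm_sq_eq_of_L2 z
  nlinarith [norm_nonneg z, norm_nonneg z.fst, norm_nonneg z.snd,
    mul_nonneg (norm_nonneg z.fst) (norm_nonneg z.snd)]

section BlockNorms

variable {z : Phase u s} {b : ℝ}

theorem norm_dXX_le (hf : DifferentiableAt ℝ f z) (hb : ‖fderiv ℝ f z‖ ≤ b) : ‖dXX f z‖ ≤ b := by
  refine ContinuousLinearMap.opNorm_le_bound _ ((norm_nonneg _).trans hb) fun a => ?_
  have h1 := fderiv_apply_fst hf (pt a 0)
  rw [show (pt a 0 : Phase u s).snd = 0 from rfl, map_zero, add_zero] at h1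
  change ‖dXX f z (pt a 0 : Phase u s).fst‖ ≤ _
  rw [← h1, ← norm_pt_zero_right (s := s) a]
  exact (WithLp.norm_fst_le _ _).trans (ContinuousLinearMap.le_of_opNorm_le _ hb _)

theorem norm_dXY_le (hf : DifferentiableAt ℝ f z) (hb : ‖fderiv ℝ f z‖ ≤ b) : ‖dXY f z‖ ≤ b := by
  refine ContinuousLinearMap.opNorm_le_bound _ ((norm_nonneg _).trans hb) fun a => ?_
  have h1 := fderiv_apply_fst hf (pt 0 a)
  rw [show (pt 0 a : Phase u s).fst = 0 from rfl, map_zero, zero_add] at h1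
  change ‖dXY f z (pt 0 a : Phase u s).snd‖ ≤ _
  rw [← h1, ← norm_pt_zero_left (u := u) a]
  exact (WithLp.norm_fst_le _ _).trans (ContinuousLinearMap.le_of_opNorm_le _ hb _)

theorem norm_dYX_le (hf : DifferentiableAt ℝ f z) (hb : ‖fderiv ℝ f z‖ ≤ b) : ‖dYX f z‖ ≤ b := by
  refine ContinuousLinearMap.opNorm_le_bound _ ((norm_nonneg _).trans hb) fun a => ?_
  have h1 := fderiv_apply_snd hf (pt a 0)
  rw [show (pt a 0 : Phase u s).snd = 0 from rfl, map_zero, add_zero] at h1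
  change ‖dYX f z (pt a 0 : Phase u s).fst‖ ≤ _
  rw [← h1, ← norm_pt_zero_right (s := s) a]
  exact (WithLp.norm_snd_le _ _).trans (ContinuousLinearMap.le_of_opNorm_le _ hb _)

theorem norm_dYY_le (hf : DifferentiableAt ℝ f z) (hb : ‖fderiv ℝ f z‖ ≤ b) : ‖dYY f z‖ ≤ b := by
  refine ContinuousLinearMap.opNorm_le_bound _ ((norm_nonneg _).trans hb) fun a => ?_
  have h1 := fderiv_apply_snd hf (pt 0 a)
  rw [show (pt 0 a : Phase u s).fst = 0 from rfl, map_zero, zero_add] at h1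
  change ‖dYY f z (pt 0 a : Phase u s).snd‖ ≤ _
  rw [← h1, ← norm_pt_zero_left (u := u) a]
  exact (WithLp.norm_snd_le _ _).trans (ContinuousLinearMap.le_of_opNorm_le _ hb _)

end BlockNorms

/-! ### Transport of slopes along a trajectory -/

/-- The pointwise bounds on the derivatives of `f` over `D` that drive the estimates: numerical
ranges and norms of the four blocks, a bound `Γ` on the forcing of the second derivative of an
invariant graph by the second derivatives of `f`, valid for all slopes of norm at most `L`, and the
two resulting rate conditions. With `ξ = m - L β` these say that the cone `‖y‖ ≤ L ‖x‖` is invariant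
and that the parabolic bound `M` exceeds `Γ / (2 ξ - (l + L β))`. -/
structure RateBounds (f : Phase u s → Phase u s) (D : Set (Phase u s)) (L M b m β γ l Γ : ℝ) :
    Prop where
  contDiffAt : ∀ z ∈ D, ContDiffAt ℝ 2 f z
  norm_fderiv : ∀ z ∈ D, ‖fderiv ℝ f z‖ ≤ b
  norm_fderiv₂ : ∀ z ∈ D, ‖fderiv ℝ (fderiv ℝ f) z‖ ≤ b
  inner_dXX : ∀ z ∈ D, ∀ a, m * ‖a‖ ^ 2 ≤ inner ℝ a (dXX f z a)
  norm_dXY : ∀ z ∈ D, ‖dXY f z‖ ≤ β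
  norm_dYX : ∀ z ∈ D, ‖dYX f z‖ ≤ γ
  inner_dYY : ∀ z ∈ D, ∀ b, inner ℝ b (dYY f z b) ≤ l * ‖b‖ ^ 2
  forcing : ∀ z ∈ D, ∀ S : EuclideanSpace ℝ (Fin u) →L[ℝ] EuclideanSpace ℝ (Fin s), ‖S‖ ≤ L →
    ∀ a, ‖(1 / 2 : ℝ) • ((fderiv ℝ (fderiv ℝ f) z (pt a (S a)) (pt a (S a))).snd
      - S (fderiv ℝ (fderiv ℝ f) z (pt a (S a)) (pt a (S a))).fst)‖ ≤ Γ * ‖a‖ ^ 2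
  pos : 0 < L
  nonneg : 0 ≤ M
  cone : l * L + γ < L * (m - L * β)
  gap : Γ < M * (2 * (m - L * β) - (l + L * β))

set_option maxHeartbeats 2000000 in
/-- The differential inequalities for the displacement `d` from a trajectory through `z`, split into
its horizontal part `a = d.fst` and its deviation `e = d.snd - S a` from the slope `S`: up to the
error `κ`, which is small on small balls, `e` grows at rate at most `l + L β` and is forced by
`Γ ‖a‖²`, while `a` grows at rate at least `m - L β`. -/
theorem RateBounds.displacement_bounds {L M b m β γ l Γ : ℝ}
    (H : RateBounds f D L M b m β γ l Γ) {z : Phase u s} (hz : z ∈ D)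
    {S : EuclideanSpace ℝ (Fin u) →L[ℝ] EuclideanSpace ℝ (Fin s)} (hS : ‖S‖ ≤ L)
    {κ ε ρ : ℝ} (hε : 0 ≤ ε) (hρ1 : ρ ≤ 1)
    (hεκ : 2 * (1 + L) ^ 3 * ε ≤ κ) (hρκ : (β + 2 * (1 + L) ^ 2 * (b + ε)) * ρ ≤ κ)
    {d v : Phase u s} (hd : ‖d‖ ≤ ρ)
    (hv : ‖v - fderiv ℝ f z d - (1 / 2 : ℝ) • fderiv ℝ (fderiv ℝ f) z d d‖ ≤ ε * ‖d‖ ^ 2) :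
    ‖v‖ ≤ (2 * b + ε) * ‖d‖ ∧
    (m - L * β - κ) * ‖d.fst‖ ^ 2 - κ * ‖d.snd - S d.fst‖ ≤ inner ℝ d.fst v.fst ∧
    inner ℝ (d.snd - S d.fst) (v.snd
        - (riccati (dXX f z) (dXY f z) (dYX f z) (dYY f z) S d.fst + S v.fst))
      ≤ ‖d.snd - S d.fst‖ * ((l + L * β + κ) * ‖d.snd - S d.fst‖ + (Γ + κ) * ‖d.fst‖ ^ 2) := by
  have hL : 0 < L := H.pos
  have hdf : DifferentiableAt ℝ f z := (H.contDiffAt z hz).differentiableAt (by norm_num)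
  have hb1 := H.norm_fderiv z hz
  have hb2 := H.norm_fderiv₂ z hz
  have hb : 0 ≤ b := (norm_nonneg _).trans hb1
  have hβ' := H.norm_dXY z hz
  have hβ : 0 ≤ β := (norm_nonneg _).trans hβ'
  set A := dXX f z with hA
  set B := dXY f z with hB
  set C := dYX f z with hC
  set N := dYY f z with hN
  set Q := fderiv ℝ (fderiv ℝ f) z with hQ
  set a := d.fst with ha
  set e := d.snd - S a with he
  set R := v - fderiv ℝ f z d - (1 / 2 : ℝ) • Q d d with hR
  set σ : Phase u s := pt a (S a) with hσ
  set τ : Phase u s := pt 0 e with hτ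
  have hdσ : d = σ + τ := phase_ext (by simp [hσ, hτ, ha]) (by simp [hσ, hτ, he])
  have hρ : 0 ≤ ρ := (norm_nonneg d).trans hd
  have na : ‖a‖ ≤ ‖d‖ := WithLp.norm_fst_le _ d
  have nS : ‖S a‖ ≤ L * ‖a‖ := S.le_of_opNorm_le hS a
  have ne : ‖e‖ ≤ (1 + L) * ρ := by
    have h1 := norm_sub_le d.snd (S a)
    have h2 : ‖d.snd‖ ≤ ‖d‖ := WithLp.norm_snd_le _ d
    linarith [mul_le_mul_of_nonneg_left (na.trans hd) hL.le]
  have nσ : ‖σ‖ ≤ (1 + L) * ‖a‖ := by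
    have := norm_le_norm_fst_add_norm_snd σ
    change ‖σ‖ ≤ ‖a‖ + ‖S a‖ at this
    linarith
  have nτ : ‖τ‖ = ‖e‖ := norm_pt_zero_left e
  have nσρ : ‖σ‖ ≤ (1 + L) * ρ := nσ.trans (mul_le_mul_of_nonneg_left (na.trans hd) (by linarith))
  have nd2 : ‖d‖ ^ 2 ≤ 2 * (1 + L) ^ 2 * ‖a‖ ^ 2 + 2 * (1 + L) * ρ * ‖e‖ := by
    have h1 : ‖d‖ ≤ (1 + L) * ‖a‖ + ‖e‖ := by
      rw [hdσ]
      refine (norm_add_le _ _).trans ?_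
      rw [nτ]
      linarith
    have h2 : ‖d‖ ^ 2 ≤ ((1 + L) * ‖a‖ + ‖e‖) ^ 2 := pow_le_pow_left₀ (norm_nonneg _) h1 2
    have h3 : ‖e‖ ^ 2 ≤ (1 + L) * ρ * ‖e‖ := by
      rw [pow_two]
      exact mul_le_mul_of_nonneg_right ne (norm_nonneg _)
    linarith [sq_nonneg ((1 + L) * ‖a‖ - ‖e‖)]
  have nQ : ∀ p q : Phase u s, ‖Q p q‖ ≤ b * ‖p‖ * ‖q‖ := fun p q =>
    (Q.le_opNorm₂ p q).trans (by gcongr)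
  have vdec : v = fderiv ℝ f z d + (1 / 2 : ℝ) • Q d d + R := by
    rw [hR]
    abel
  have nhalf : ∀ p : Phase u s, ‖(1 / 2 : ℝ) • p‖ = ‖p‖ / 2 := fun p => by
    rw [norm_smul]
    norm_num
    ring
  have hdfst : (fderiv ℝ f z d).fst = A a + B (S a) + B e := by
    rw [fderiv_apply_fst hdf d, add_assoc, ← map_add]
    congr 2
    simp [he]
  have hdsnd : (fderiv ℝ f z d).snd = C a + N (S a) + N e := by
    rw [fderiv_apply_snd hdf d, add_assoc, ← map_add]
    congr 2
    simp [he]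
  have ε1 : ε * ‖d‖ ^ 2 ≤ ε * (2 * (1 + L) ^ 2 * ‖a‖ ^ 2 + 2 * (1 + L) * ρ * ‖e‖) :=
    mul_le_mul_of_nonneg_left nd2 hε
  refine ⟨?_, ?_, ?_⟩
  · have h1 : ‖v‖ ≤ ‖fderiv ℝ f z d‖ + ‖(1 / 2 : ℝ) • Q d d‖ + ‖R‖ := by
      conv_lhs => rw [vdec]
      exact norm_add₃_le
    have h2 := (fderiv ℝ f z).le_of_opNorm_le hb1 d
    have h3 := nQ d d
    rw [nhalf] at h1
    have h4 : ‖d‖ * ‖d‖ ≤ ‖d‖ := mul_le_of_le_one_right (norm_nonneg _) (hd.trans hρ1)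
    have h5 := mul_le_mul_of_nonneg_left h4 hb
    have h6 := mul_le_mul_of_nonneg_left h4 hε
    linarith [mul_nonneg hb (norm_nonneg d)]
  · set W : Phase u s := (1 / 2 : ℝ) • Q d d + R with hW
    have hvf : v.fst = A a + B (S a) + B e + W.fst := by
      rw [← hdfst, ← WithLp.add_fst, hW, ← add_assoc, ← vdec]
    have nW : ‖W.fst‖ ≤ (b + ε) * ‖d‖ ^ 2 := by
      refine (WithLp.norm_fst_le _ _).trans ((norm_add_le _ _).trans ?_)
      rw [nhalf]
      have h3 := nQ d d
      linarith [mul_nonneg hb (sq_nonneg ‖d‖)]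
    have h1 := H.inner_dXX z hz a
    have h2 := (abs_le.1 (abs_real_inner_le_norm a (B (S a)))).1
    have h3 := (abs_le.1 (abs_real_inner_le_norm a (B e))).1
    have h4 := (abs_le.1 (abs_real_inner_le_norm a W.fst)).1
    have i2 : ‖a‖ * ‖B (S a)‖ ≤ ‖a‖ * (β * (L * ‖a‖)) :=
      mul_le_mul_of_nonneg_left ((B.le_of_opNorm_le hβ' _).trans
        (mul_le_mul_of_nonneg_left nS hβ)) (norm_nonneg _)
    have i3 : ‖a‖ * ‖B e‖ ≤ ρ * (β * ‖e‖) :=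
      mul_le_mul (na.trans hd) (B.le_of_opNorm_le hβ' _) (norm_nonneg _) hρ
    have i4 : ‖a‖ * ‖W.fst‖ ≤ ρ * ((b + ε) *
        (2 * (1 + L) ^ 2 * ‖a‖ ^ 2 + 2 * (1 + L) * ρ * ‖e‖)) :=
      mul_le_mul (na.trans hd) (nW.trans (mul_le_mul_of_nonneg_left nd2 (by positivity)))
        (norm_nonneg _) hρ
    have j1 : (b + ε) * (2 * (1 + L) ^ 2) * ρ * ‖a‖ ^ 2 ≤ κ * ‖a‖ ^ 2 :=
      mul_le_mul_of_nonneg_right (by linarith [mul_nonneg hβ hρ]) (sq_nonneg _)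
    have j2 : (β + (b + ε) * (2 * (1 + L) * ρ)) * ρ * ‖e‖ ≤ κ * ‖e‖ := by
      refine mul_le_mul_of_nonneg_right (le_trans ?_ hρκ) (norm_nonneg _)
      refine mul_le_mul_of_nonneg_right (add_le_add le_rfl ?_) hρ
      have k1 : 2 * (1 + L) * ρ ≤ 2 * (1 + L) ^ 2 := by
        linarith [mul_le_mul_of_nonneg_left (show ρ ≤ 1 + L by linarith)
          (show 0 ≤ 2 * (1 + L) by linarith)]
      linarith [mul_le_mul_of_nonneg_left k1 (add_nonneg hb hε)]
    rw [hvf, inner_add_right, inner_add_right, inner_add_right]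
    linarith
  · set P : Phase u s := (1 / 2 : ℝ) • (Q σ τ + Q τ d) + R with hP
    have hQd : Q d d = Q σ σ + (Q σ τ + Q τ d) := by
      have h1 : Q d d = Q σ d + Q τ d := by
        have h0 : Q d = Q σ + Q τ := by rw [← map_add, ← hdσ]
        rw [h0]
        rfl
      have h2 : Q σ d = Q σ σ + Q σ τ := by
        rw [← map_add, ← hdσ]
      rw [h1, h2, add_assoc]
    have hvdec : v = fderiv ℝ f z d + (1 / 2 : ℝ) • Q σ σ + P := by
      rw [hP, ← add_assoc, add_assoc (fderiv ℝ f z d), ← smul_add, ← hQd, ← vdec]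
    have hvf : v.fst = A a + B (S a) + B e + (1 / 2 : ℝ) • (Q σ σ).fst + P.fst := by
      conv_lhs => rw [hvdec]
      rw [WithLp.add_fst, WithLp.add_fst, WithLp.smul_fst, hdfst]
    have hvs : v.snd = C a + N (S a) + N e + (1 / 2 : ℝ) • (Q σ σ).snd + P.snd := by
      conv_lhs => rw [hvdec]
      rw [WithLp.add_snd, WithLp.add_snd, WithLp.smul_snd, hdsnd]
    -- The Riccati equation removes all terms linear in `a`.
    have hdec : v.snd - (riccati A B C N S a + S v.fst)
        = N e - S (B e) + (1 / 2 : ℝ) • ((Q σ σ).snd - S (Q σ σ).fst) + (P.snd - S P.fst) := by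
      rw [hvf, hvs]
      simp only [riccati, map_add, map_smul, sub_apply, add_apply,
        ContinuousLinearMap.comp_apply]
      module
    have nP : ‖P‖ ≤ 2 * b * (1 + L) * ρ * ‖e‖ + ε * ‖d‖ ^ 2 := by
      refine (norm_add_le _ _).trans (add_le_add ?_ hv)
      rw [nhalf]
      have h1 := norm_add_le (Q σ τ) (Q τ d)
      have h2 : ‖Q σ τ‖ ≤ b * ((1 + L) * ρ) * ‖e‖ := (nQ σ τ).trans (by rw [nτ]; gcongr)
      have h3 : ‖Q τ d‖ ≤ b * ‖e‖ * ρ := (nQ τ d).trans (by rw [nτ]; gcongr)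
      have h4 : 0 ≤ b * ‖e‖ * ρ := by positivity
      have h5 : 0 ≤ L * (b * ‖e‖ * ρ) := by positivity
      linarith
    have nSP : ‖P.snd - S P.fst‖ ≤ (1 + L) * ‖P‖ := by
      have h1 := norm_sub_le P.snd (S P.fst)
      have h2 : ‖P.snd‖ ≤ ‖P‖ := WithLp.norm_snd_le _ P
      have h3 : ‖S P.fst‖ ≤ L * ‖P‖ := (S.le_of_opNorm_le hS _).trans
        (mul_le_mul_of_nonneg_left (WithLp.norm_fst_le _ P) hL.le)
      linarith
    have nF := H.forcing z hz S hS a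
    have k0 := H.inner_dYY z hz e
    have k1 := (abs_le.1 (abs_real_inner_le_norm e (S (B e)))).1
    have k2 := real_inner_le_norm e ((1 / 2 : ℝ) • ((Q σ σ).snd - S (Q σ σ).fst))
    have k3 := real_inner_le_norm e (P.snd - S P.fst)
    have l1 : ‖e‖ * ‖S (B e)‖ ≤ ‖e‖ * (L * (β * ‖e‖)) :=
      mul_le_mul_of_nonneg_left ((S.le_of_opNorm_le hS _).trans
        (mul_le_mul_of_nonneg_left (B.le_of_opNorm_le hβ' _) hL.le)) (norm_nonneg _)
    have l2 := mul_le_mul_of_nonneg_left nF (norm_nonneg e)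
    have l3 : ‖P.snd - S P.fst‖ ≤ κ * ‖e‖ + κ * ‖a‖ ^ 2 := by
      refine nSP.trans ?_
      have q1 : (1 + L) * ‖P‖ ≤ (1 + L) * (2 * b * (1 + L) * ρ * ‖e‖
          + ε * (2 * (1 + L) ^ 2 * ‖a‖ ^ 2 + 2 * (1 + L) * ρ * ‖e‖)) :=
        mul_le_mul_of_nonneg_left (nP.trans (by linarith)) (by linarith)
      have q2 : 2 * (1 + L) ^ 2 * (b + ε) * ρ * ‖e‖ ≤ κ * ‖e‖ :=
        mul_le_mul_of_nonneg_right (by linarith [mul_nonneg hβ hρ]) (norm_nonneg _)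
      have q3 := mul_le_mul_of_nonneg_right hεκ (sq_nonneg ‖a‖)
      refine q1.trans ((le_of_eq ?_).trans (add_le_add q2 q3))
      ring
    have l4 := mul_le_mul_of_nonneg_left l3 (norm_nonneg e)
    rw [hdec, inner_add_right, inner_add_right, inner_sub_right]
    linarith

/-- Along a trajectory in `D`, a slope at the starting point is carried to a slope at the end point
so that graphs within a parabola of constant `M` around the former are carried to graphs within a
parabola of the same constant around the latter. -/
theorem RateBounds.exists_slope_transport {L M b m β γ l Γ : ℝ}
    (H : RateBounds f D L M b m β γ l Γ) {T : ℝ} (hT : 0 ≤ T) {φ : ℝ → Phase u s}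
    (hφ : ∀ t ∈ Icc 0 T, φ t ∈ D ∧ HasDerivWithinAt φ (f (φ t)) (Icc 0 T) t)
    {S₀ : EuclideanSpace ℝ (Fin u) →L[ℝ] EuclideanSpace ℝ (Fin s)} (hS₀ : ‖S₀‖ ≤ L) :
    ∃ S₁ : EuclideanSpace ℝ (Fin u) →L[ℝ] EuclideanSpace ℝ (Fin s), ‖S₁‖ ≤ L ∧ ∃ ρ > 0,
      ∀ ψ : ℝ → Phase u s, (∀ t ∈ Icc 0 T, HasDerivWithinAt ψ (f (ψ t)) (Icc 0 T) t) →
        ‖ψ 0 - φ 0‖ ≤ ρ →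
        ‖(ψ 0 - φ 0).snd - S₀ (ψ 0 - φ 0).fst‖ ≤ M * ‖(ψ 0 - φ 0).fst‖ ^ 2 →
        ‖(ψ T - φ T).snd - S₁ (ψ T - φ T).fst‖ ≤ M * ‖(ψ T - φ T).fst‖ ^ 2 := by
  have hL : 0 < L := H.pos
  have hM : 0 ≤ M := H.nonneg
  have hφc : ContinuousOn φ (Icc 0 T) := fun t ht => (hφ t ht).2.continuousWithinAt
  have hdiff : ∀ z ∈ D, DifferentiableAt ℝ f z := fun z hz =>
    (H.contDiffAt z hz).differentiableAt (by norm_num)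
  have h0T : (0 : ℝ) ∈ Icc 0 T := left_mem_Icc.2 hT
  have hb : 0 ≤ b := (norm_nonneg _).trans (H.norm_fderiv _ (hφ 0 h0T).1)
  have hβ : 0 ≤ β := (norm_nonneg _).trans (H.norm_dXY _ (hφ 0 h0T).1)
  have hDc : ContinuousOn (fun t => fderiv ℝ f (φ t)) (Icc 0 T) := fun t ht =>
    ((H.contDiffAt _ (hφ t ht).1).fderiv_right (m := 1)
      (by norm_num)).continuousAt.comp_continuousWithinAt (hφc t ht)
  have hXc : ContinuousOn (fun t => fderiv ℝ (compX f) (φ t)) (Icc 0 T) :=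
    (continuousOn_const.clm_comp hDc).congr fun t ht =>
      (hasFDerivAt_compX (hdiff _ (hφ t ht).1)).fderiv
  have hYc : ContinuousOn (fun t => fderiv ℝ (compY f) (φ t)) (Icc 0 T) :=
    (continuousOn_const.clm_comp hDc).congr fun t ht =>
      (hasFDerivAt_compY (hdiff _ (hφ t ht).1)).fderiv
  obtain ⟨S, hS0, hS⟩ := exists_riccati_solution hT
    (A := fun t => dXX f (φ t)) (B := fun t => dXY f (φ t)) (C := fun t => dYX f (φ t))
    (N := fun t => dYY f (φ t)) (b := b)
    (hXc.clm_comp continuousOn_const) (hXc.clm_comp continuousOn_const)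
    (hYc.clm_comp continuousOn_const) (hYc.clm_comp continuousOn_const) hL H.cone
    (fun t ht => H.inner_dXX _ (hφ t ht).1) (fun t ht => H.norm_dXY _ (hφ t ht).1)
    (fun t ht => H.norm_dYX _ (hφ t ht).1) (fun t ht => H.inner_dYY _ (hφ t ht).1)
    (fun t ht => norm_dXX_le (hdiff _ (hφ t ht).1) (H.norm_fderiv _ (hφ t ht).1))
    (fun t ht => norm_dXY_le (hdiff _ (hφ t ht).1) (H.norm_fderiv _ (hφ t ht).1))
    (fun t ht => norm_dYX_le (hdiff _ (hφ t ht).1) (H.norm_fderiv _ (hφ t ht).1))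
    (fun t ht => norm_dYY_le (hdiff _ (hφ t ht).1) (H.norm_fderiv _ (hφ t ht).1)) hS₀
  -- The error `κ` spends the gap in the second rate condition.
  set κ := (M * (2 * (m - L * β) - (l + L * β)) - Γ) / (1 + 3 * M + 2 * M ^ 2) with hκ
  have hden : 0 < 1 + 3 * M + 2 * M ^ 2 := by positivity
  have hκ0 : 0 < κ := div_pos (sub_pos.2 H.gap) hden
  have hκe : κ * (1 + 3 * M + 2 * M ^ 2) = M * (2 * (m - L * β) - (l + L * β)) - Γ :=
    div_mul_cancel₀ _ hden.ne'
  set ε := κ / (2 * (1 + L) ^ 3) with hε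
  have hε0 : 0 < ε := by positivity
  have hεκ : 2 * (1 + L) ^ 3 * ε ≤ κ := (mul_div_cancel₀ κ (by positivity)).le
  obtain ⟨ρ₀, hρ₀, hTay⟩ := exists_uniform_taylor_two (isCompact_Icc.image_of_continuousOn hφc)
    (f := f) (by
      rintro _ ⟨t, ht, rfl⟩
      exact H.contDiffAt _ (hφ t ht).1) hε0
  set c := β + 2 * (1 + L) ^ 2 * (b + ε) with hc
  have hc0 : 0 < c := by positivity
  set ρ := min ρ₀ (min 1 (κ / c)) with hρ
  have hρ0 : 0 < ρ := lt_min hρ₀ (lt_min one_pos (by positivity))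
  have hρ1 : ρ ≤ 1 := (min_le_right _ _).trans (min_le_left _ _)
  have hρκ : c * ρ ≤ κ := by
    have : ρ ≤ κ / c := (min_le_right _ _).trans (min_le_right _ _)
    rw [le_div_iff₀ hc0] at this
    linarith
  refine ⟨S T, (hS T (right_mem_Icc.2 hT)).1, ρ * Real.exp (-((2 * b + ε + 1) * T)),
    by positivity, ?_⟩
  intro ψ hψ hψ0 hpar
  have hd : ∀ t ∈ Icc 0 T, HasDerivWithinAt (fun t => ψ t - φ t) (f (ψ t) - f (φ t)) (Icc 0 T) t :=
    fun t ht => (hψ t ht).sub (hφ t ht).2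
  have hbounds : ∀ t ∈ Icc 0 T, ‖ψ t - φ t‖ ≤ ρ → _ := fun t ht hle =>
    H.displacement_bounds (hφ t ht).1 (hS t ht).1 hε0.le hρ1 hεκ hρκ hle
      (v := f (ψ t) - f (φ t)) (by
        have := hTay _ ⟨t, ht, rfl⟩ (ψ t - φ t) (hle.trans (min_le_left _ _))
        rwa [add_sub_cancel] at this)
  have hsmall : ∀ t ∈ Icc 0 T, ‖ψ t - φ t‖ ≤ ρ := fun t ht =>
    norm_le_of_local_deriv_bound (d := fun t => ψ t - φ t) (K := 2 * b + ε) (by positivity) hρ0 hd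
      (fun t ht hle => (hbounds t ht hle).1) hψ0 ht
  have hfst : ∀ t ∈ Icc 0 T, HasDerivWithinAt (fun t => (ψ t - φ t).fst)
      (f (ψ t) - f (φ t)).fst (Icc 0 T) t := fun t ht =>
    (WithLp.fstL 2 ℝ (EuclideanSpace ℝ (Fin u))
      (EuclideanSpace ℝ (Fin s))).hasFDerivAt.comp_hasDerivWithinAt t (hd t ht)
  have hsnd : ∀ t ∈ Icc 0 T, HasDerivWithinAt (fun t => (ψ t - φ t).snd)
      (f (ψ t) - f (φ t)).snd (Icc 0 T) t := fun t ht =>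
    (WithLp.sndL 2 ℝ (EuclideanSpace ℝ (Fin u))
      (EuclideanSpace ℝ (Fin s))).hasFDerivAt.comp_hasDerivWithinAt t (hd t ht)
  exact norm_le_mul_sq_of_deriv_bounds (a := fun t => (ψ t - φ t).fst)
    (e := fun t => (ψ t - φ t).snd - S t (ψ t - φ t).fst)
    hfst (fun t ht => (hsnd t ht).sub ((hS t ht).2.clm_apply (hfst t ht)))
    (fun t ht => (hbounds t ht (hsmall t ht)).2.2)
    (fun t ht => (hbounds t ht (hsmall t ht)).2.1) hM
    (by nlinarith) (by simpa only [hS0] using hpar) (right_mem_Icc.2 hT)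

/-! ### Quadratic slopes of graphs and the graph transform -/

/-- `S`, of norm at most `L`, is a derivative of `v` at `x` within `X` with first-order remainder at
most `M ‖x' - x‖²` on some neighbourhood of `x` within `X`, whose size is not controlled. -/
def HasQuadraticSlope {E F : Type*} [NormedAddCommGroup E] [NormedSpace ℝ E]
    [NormedAddCommGroup F] [NormedSpace ℝ F] (X : Set E) (L M : ℝ) (v : E → F) (x : E)
    (S : E →L[ℝ] F) : Prop :=
  ‖S‖ ≤ L ∧ ∀ᶠ x' in 𝓝[X] x, ‖v x' - v x - S (x' - x)‖ ≤ M * ‖x' - x‖ ^ 2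

theorem hasFDerivWithinAt_of_quadratic_bound {E F : Type*} [NormedAddCommGroup E] [NormedSpace ℝ E]
    [NormedAddCommGroup F] [NormedSpace ℝ F] {X : Set E} {M : ℝ} {v : E → F} {x : E}
    {S : E →L[ℝ] F} (hx : x ∈ X)
    (h : ∀ᶠ x' in 𝓝[X] x, ‖v x' - v x - S (x' - x)‖ ≤ M * ‖x' - x‖ ^ 2) :
    HasFDerivWithinAt v S X x := by
  have hO : (fun x' => v x' - v x - S (x' - x)) =O[𝓝[X] x] fun x' => ‖x' - x‖ ^ 2 := by
    refine Asymptotics.IsBigO.of_bound M (h.mono fun x' hx' => ?_)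
    simpa using hx'
  have h1 := (hO.hasFDerivWithinAt hx (by norm_num)).add
    ((S.hasFDerivWithinAt (s := X) (x := x)).add_const (v x - S x))
  rw [zero_add] at h1
  refine h1.congr (fun y _ => ?_) ?_
  · simp only [Pi.add_apply, map_sub]
    abel
  · simp

/-- The graph transform preserves the existence of quadratic slopes at all points, with the same
constants. -/
theorem RateBounds.exists_quadraticSlope_graphTransform {L M b m β γ l Γ h : ℝ}
    (H : RateBounds f D L M b m β γ l Γ) (hh : 0 ≤ h)
    {v v' : EuclideanSpace ℝ (Fin u) → EuclideanSpace ℝ (Fin s)}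
    (hG : IsGraphTransform f D h v v')
    (hv : ∀ x ∈ projX D, ∃ S, HasQuadraticSlope (projX D) L M v x S) :
    ∀ x ∈ projX D, ∃ S, HasQuadraticSlope (projX D) L M v' x S := by
  intro x hx
  obtain ⟨r, hrc, hrX, hflow, -⟩ := hG
  obtain ⟨φ, hφ0, hφh, hφ⟩ := hflow x hx
  obtain ⟨S₀, hS₀, hloc⟩ := hv (r x) (hrX hx)
  obtain ⟨S₁, hS₁, ρ, hρ, htr⟩ := H.exists_slope_transport hh hφ hS₀
  refine ⟨S₁, hS₁, ?_⟩
  have hrt : Tendsto r (𝓝[projX D] x) (𝓝[projX D] (r x)) :=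
    tendsto_nhdsWithin_iff.2 ⟨hrc x hx, eventually_mem_nhdsWithin.mono fun y hy => hrX hy⟩
  have hvt : Tendsto (fun x' => v (r x')) (𝓝[projX D] x) (𝓝 (v (r x))) :=
    ((hasFDerivWithinAt_of_quadratic_bound (hrX hx) hloc).continuousWithinAt).tendsto.comp hrt
  filter_upwards [eventually_mem_nhdsWithin, hrt.eventually hloc,
    (hrt.mono_right nhdsWithin_le_nhds) (Metric.ball_mem_nhds _ (half_pos hρ)),
    hvt (Metric.ball_mem_nhds _ (half_pos hρ))] with x' hx' hpar hr1 hr2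
  have hr1' : ‖r x' - r x‖ < ρ / 2 := by rw [← dist_eq_norm]; exact hr1
  have hr2' : ‖v (r x') - v (r x)‖ < ρ / 2 := by rw [← dist_eq_norm]; exact hr2
  obtain ⟨ψ, hψ0, hψh, hψ⟩ := hflow x' hx'
  have := htr ψ (fun t ht => (hψ t ht).2) (by
    rw [hψ0, hφ0]
    refine (norm_le_norm_fst_add_norm_snd _).trans ?_
    change ‖r x' - r x‖ + ‖v (r x') - v (r x)‖ ≤ ρ
    linarith) (by
    rw [hψ0, hφ0]
    exact hpar)
  rw [hψh, hφh] at this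
  exact this

theorem RateBounds.exists_quadraticSlope_iterate {L M b m β γ l Γ h : ℝ}
    (H : RateBounds f D L M b m β γ l Γ) (hh : 0 ≤ h)
    {V : ℕ → EuclideanSpace ℝ (Fin u) → EuclideanSpace ℝ (Fin s)} (hV0 : V 0 = 0)
    (hV : ∀ n, IsGraphTransform f D h (V n) (V (n + 1))) (n : ℕ) :
    ∀ x ∈ projX D, ∃ S, HasQuadraticSlope (projX D) L M (V n) x S := by
  induction n with
  | zero =>
    refine fun x _ => ⟨0, by simpa using H.pos.le, Eventually.of_forall fun x' => ?_⟩
    have := mul_nonneg H.nonneg (sq_nonneg ‖x' - x‖)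
    simpa [hV0] using this
  | succ n ih => exact H.exists_quadraticSlope_graphTransform hh (hV n) ih

/-- On convex sets quadratic slopes give the first-order Taylor estimate without restriction to
small neighbourhoods. -/
theorem norm_taylor_le_of_quadraticSlope {E F : Type*} [NormedAddCommGroup E] [NormedSpace ℝ E]
    [NormedAddCommGroup F] [InnerProductSpace ℝ F] {K X : Set E} (hK : Convex ℝ K) (hKX : K ⊆ X)
    {L M : ℝ} (hM : 0 ≤ M) {v : E → F} {S : E → E →L[ℝ] F}
    (hS : ∀ x ∈ X, HasQuadraticSlope X L M v x (S x)) {x d : E} (hx : x ∈ K) (hd : x + d ∈ K) :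
    ‖v (x + d) - v x - S x d‖ ≤ M * ‖d‖ ^ 2 := by
  have hseg : ∀ t ∈ Icc (0 : ℝ) 1, x + t • d ∈ X := fun t ht => by
    have := hK.add_smul_sub_mem hx hd ht
    rw [add_sub_cancel_left] at this
    exact hKX this
  have := norm_taylor_le_of_local (φ := fun t : ℝ => v (x + t • d))
    (φ' := fun t : ℝ => S (x + t • d) d) (c := M * ‖d‖ ^ 2) (by positivity) (by
      intro t ht
      have hc : Continuous fun r : ℝ => x + r • d := by fun_prop
      have htend : Tendsto (fun r : ℝ => x + r • d) (𝓝[Icc 0 1] t) (𝓝[X] (x + t • d)) :=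
        tendsto_nhdsWithin_iff.2 ⟨(hc.tendsto t).mono_left nhdsWithin_le_nhds,
          eventually_mem_nhdsWithin.mono hseg⟩
      filter_upwards [htend.eventually (hS _ (hseg t ht)).2] with r hr
      have e : x + r • d - (x + t • d) = (r - t) • d := by module
      rw [e, map_smul, norm_smul, mul_pow, Real.norm_eq_abs, sq_abs] at hr
      linarith)
  simpa using this

/-- A pointwise limit of functions that satisfy a first-order Taylor estimate with slopes in a
common ball satisfies the same estimate, by compactness of the ball. -/
theorem exists_slope_of_tendsto {E F : Type*} [NormedAddCommGroup E] [NormedSpace ℝ E]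
    [FiniteDimensional ℝ E] [NormedAddCommGroup F] [NormedSpace ℝ F] [FiniteDimensional ℝ F]
    {K : Set E} {L M : ℝ} {V : ℕ → E → F} {w : E → F}
    (hw : ∀ x ∈ K, Tendsto (fun n => V n x) atTop (𝓝 (w x))) {x : E} (hx : x ∈ K)
    {S : ℕ → E →L[ℝ] F} (hSL : ∀ n, ‖S n‖ ≤ L)
    (hS : ∀ n d, x + d ∈ K → ‖V n (x + d) - V n x - S n d‖ ≤ M * ‖d‖ ^ 2) :
    ∃ A : E →L[ℝ] F, ∀ d, x + d ∈ K → ‖w (x + d) - w x - A d‖ ≤ M * ‖d‖ ^ 2 := by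
  have : ProperSpace (E →L[ℝ] F) := FiniteDimensional.proper_real _
  obtain ⟨A, -, k, hk, hA⟩ := (isCompact_closedBall (0 : E →L[ℝ] F) L).tendsto_subseq
    (x := S) (fun n => by simpa using hSL n)
  refine ⟨A, fun d hd => ?_⟩
  have h1 : Tendsto (fun n => S (k n) d) atTop (𝓝 (A d)) :=
    ((ContinuousLinearMap.apply ℝ F d).continuous.tendsto A).comp hA
  have h2 := ((((hw _ hd).comp hk.tendsto_atTop).sub ((hw _ hx).comp hk.tendsto_atTop)).sub h1).norm
  exact le_of_tendsto h2 (Eventually.of_forall fun n => hS (k n) d hd)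

/-! ### The constants bound the derivatives of the vector field -/

section Constants

variable {F : Type*} [NormedAddCommGroup F] [NormedSpace ℝ F] {B : ℝ}

theorem norm_apply_self_le_of_sSup {Q : Phase u s → Phase u s →L[ℝ] Phase u s →L[ℝ] F}
    (hQ : ∀ p ∈ D, ‖Q p‖ ≤ B) {p : Phase u s} (hp : p ∈ D) (v : Phase u s) :
    ‖(1 / 2 : ℝ) • Q p v v‖ ≤ (1 / 2 * sSup {r | ∃ p ∈ D, ∃ v : Phase u s, ‖v‖ = 1 ∧
      r = ‖Q p v v‖}) * ‖v‖ ^ 2 := by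
  rcases eq_or_ne v 0 with rfl | hv
  · simp
  have hbd : BddAbove {r | ∃ p ∈ D, ∃ v : Phase u s, ‖v‖ = 1 ∧ r = ‖Q p v v‖} := by
    refine ⟨B, ?_⟩
    rintro _ ⟨p, hp, v, hv, rfl⟩
    have := (Q p).le_opNorm₂ v v
    rw [hv, mul_one, mul_one] at this
    exact this.trans (hQ p hp)
  have hn : ‖v‖ ≠ 0 := norm_ne_zero_iff.2 hv
  have h1 := le_csSup hbd ⟨p, hp, ‖v‖⁻¹ • v,
    by rw [norm_smul, norm_inv, norm_norm, inv_mul_cancel₀ hn], rfl⟩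
  have h2 : v = ‖v‖ • (‖v‖⁻¹ • v) := by rw [smul_inv_smul₀ hn]
  have h3 : ‖Q p v v‖ = ‖v‖ ^ 2 * ‖Q p (‖v‖⁻¹ • v) (‖v‖⁻¹ • v)‖ := by
    conv_lhs => rw [h2]
    simp only [map_smul, smul_apply, norm_smul, norm_norm]
    ring
  rw [norm_smul, h3, Real.norm_of_nonneg (by norm_num : (0 : ℝ) ≤ 1 / 2)]
  have := mul_le_mul_of_nonneg_left h1 (sq_nonneg ‖v‖)
  linarith

theorem cX_nonneg (f : Phase u s → Phase u s) (D : Set (Phase u s)) : 0 ≤ cX f D :=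
  mul_nonneg (by norm_num) (Real.sSup_nonneg (by rintro _ ⟨p, _, v, _, rfl⟩; exact norm_nonneg _))

theorem cY_nonneg (f : Phase u s → Phase u s) (D : Set (Phase u s)) : 0 ≤ cY f D :=
  mul_nonneg (by norm_num) (Real.sSup_nonneg (by rintro _ ⟨p, _, v, _, rfl⟩; exact norm_nonneg _))

theorem cY₁_nonneg (f : Phase u s → Phase u s) (D : Set (Phase u s)) : 0 ≤ cY₁ f D :=
  Real.sSup_nonneg (by rintro _ ⟨p, _, rfl⟩; positivity)

theorem cY₂_nonneg (f : Phase u s → Phase u s) (D : Set (Phase u s)) : 0 ≤ cY₂ f D :=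
  Real.sSup_nonneg (by rintro _ ⟨p, _, rfl⟩; positivity)

theorem cY₃_nonneg (f : Phase u s → Phase u s) (D : Set (Phase u s)) : 0 ≤ cY₃ f D :=
  Real.sSup_nonneg (by rintro _ ⟨p, _, rfl⟩; positivity)

/-- Post-composition with a continuous linear map commutes with second derivatives. -/
theorem fderiv_fderiv_clm_comp (T : Phase u s →L[ℝ] F) {z : Phase u s}
    (hf : ContDiffAt ℝ 2 f z) :
    fderiv ℝ (fderiv ℝ fun y => T (f y)) z
      = (ContinuousLinearMap.compL ℝ (Phase u s) (Phase u s) F T).comp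
        (fderiv ℝ (fderiv ℝ f) z) := by
  have h1 : fderiv ℝ (fun y => T (f y)) =ᶠ[𝓝 z] fun y => T.comp (fderiv ℝ f y) := by
    filter_upwards [hf.eventually (by simp)] with y hy
    exact (T.hasFDerivAt.comp y (hy.differentiableAt (by norm_num)).hasFDerivAt).fderiv
  have h2 : DifferentiableAt ℝ (fderiv ℝ f) z :=
    (hf.fderiv_right (m := 1) (by norm_num)).differentiableAt (by norm_num)
  rw [h1.fderiv_eq]
  exact ((ContinuousLinearMap.compL ℝ (Phase u s) (Phase u s) F T).hasFDerivAt.comp z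
    h2.hasFDerivAt).fderiv

theorem fderiv_fderiv_compX_apply {z : Phase u s} (hf : ContDiffAt ℝ 2 f z) (v w : Phase u s) :
    fderiv ℝ (fderiv ℝ (compX f)) z v w = (fderiv ℝ (fderiv ℝ f) z v w).fst := by
  have := fderiv_fderiv_clm_comp
    (WithLp.fstL 2 ℝ (EuclideanSpace ℝ (Fin u)) (EuclideanSpace ℝ (Fin s))) hf
  change fderiv ℝ (fderiv ℝ fun y => WithLp.fstL 2 ℝ (EuclideanSpace ℝ (Fin u))
    (EuclideanSpace ℝ (Fin s)) (f y)) z v w = _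
  rw [this]
  rfl

theorem fderiv_fderiv_compY_apply {z : Phase u s} (hf : ContDiffAt ℝ 2 f z) (v w : Phase u s) :
    fderiv ℝ (fderiv ℝ (compY f)) z v w = (fderiv ℝ (fderiv ℝ f) z v w).snd := by
  have := fderiv_fderiv_clm_comp
    (WithLp.sndL 2 ℝ (EuclideanSpace ℝ (Fin u)) (EuclideanSpace ℝ (Fin s))) hf
  change fderiv ℝ (fderiv ℝ fun y => WithLp.sndL 2 ℝ (EuclideanSpace ℝ (Fin u))
    (EuclideanSpace ℝ (Fin s)) (f y)) z v w = _
  rw [this]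
  rfl

theorem norm_fderiv_fderiv_compX_le {z : Phase u s} (hf : ContDiffAt ℝ 2 f z)
    (hB : ‖fderiv ℝ (fderiv ℝ f) z‖ ≤ B) : ‖fderiv ℝ (fderiv ℝ (compX f)) z‖ ≤ B := by
  refine ContinuousLinearMap.opNorm_le_bound₂ _
    ((ContinuousLinearMap.opNorm_nonneg _).trans hB) fun v w => ?_
  rw [fderiv_fderiv_compX_apply hf]
  refine (WithLp.norm_fst_le _ _).trans ((ContinuousLinearMap.le_opNorm₂ _ v w).trans ?_)
  gcongr

theorem norm_fderiv_fderiv_compY_le {z : Phase u s} (hf : ContDiffAt ℝ 2 f z)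
    (hB : ‖fderiv ℝ (fderiv ℝ f) z‖ ≤ B) : ‖fderiv ℝ (fderiv ℝ (compY f)) z‖ ≤ B := by
  refine ContinuousLinearMap.opNorm_le_bound₂ _
    ((ContinuousLinearMap.opNorm_nonneg _).trans hB) fun v w => ?_
  rw [fderiv_fderiv_compY_apply hf]
  refine (WithLp.norm_snd_le _ _).trans ((ContinuousLinearMap.le_opNorm₂ _ v w).trans ?_)
  gcongr

theorem norm_bilinearComp_le {E₁ E₂ : Type*} [NormedAddCommGroup E₁] [NormedSpace ℝ E₁]
    [NormedAddCommGroup E₂] [NormedSpace ℝ E₂] (Q : Phase u s →L[ℝ] Phase u s →L[ℝ] F)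
    (hQ : ‖Q‖ ≤ B) {i : E₁ →L[ℝ] Phase u s} {j : E₂ →L[ℝ] Phase u s}
    (hi : ∀ a, ‖i a‖ = ‖a‖) (hj : ∀ a, ‖j a‖ = ‖a‖) : ‖Q.bilinearComp i j‖ ≤ B := by
  refine ContinuousLinearMap.opNorm_le_bound₂ _
    ((ContinuousLinearMap.opNorm_nonneg _).trans hQ) fun v w => ?_
  rw [ContinuousLinearMap.bilinearComp_apply]
  refine (Q.le_opNorm₂ _ _).trans ?_
  rw [hi, hj]
  gcongr

section Forcing

variable {L : ℝ} {z : Phase u s} {S : EuclideanSpace ℝ (Fin u) →L[ℝ] EuclideanSpace ℝ (Fin s)}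

theorem norm_half_fst_le (hf : ∀ z ∈ D, ContDiffAt ℝ 2 f z)
    (hB : ∀ z ∈ D, ‖fderiv ℝ (fderiv ℝ f) z‖ ≤ B) (hz : z ∈ D) (hS : ‖S‖ ≤ L)
    (a : EuclideanSpace ℝ (Fin u)) :
    ‖(1 / 2 : ℝ) • (fderiv ℝ (fderiv ℝ f) z (pt a (S a)) (pt a (S a))).fst‖
      ≤ cX f D * (1 + L ^ 2) * ‖a‖ ^ 2 := by
  rw [← fderiv_fderiv_compX_apply (hf z hz)]
  refine (norm_apply_self_le_of_sSup
    (fun p hp => norm_fderiv_fderiv_compX_le (hf p hp) (hB p hp)) hz _).trans ?_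
  rw [WithLp.prod_norm_sq_eq_of_L2, mul_assoc (cX f D)]
  refine mul_le_mul_of_nonneg_left ?_ (cX_nonneg f D)
  have := pow_le_pow_left₀ (norm_nonneg _) (S.le_of_opNorm_le hS a) 2
  change ‖a‖ ^ 2 + ‖S a‖ ^ 2 ≤ _
  linarith

theorem norm_half_snd_le (hf : ∀ z ∈ D, ContDiffAt ℝ 2 f z)
    (hB : ∀ z ∈ D, ‖fderiv ℝ (fderiv ℝ f) z‖ ≤ B) (hz : z ∈ D) (hS : ‖S‖ ≤ L)
    (a : EuclideanSpace ℝ (Fin u)) :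
    ‖(1 / 2 : ℝ) • (fderiv ℝ (fderiv ℝ f) z (pt a (S a)) (pt a (S a))).snd‖
      ≤ cY f D * (1 + L ^ 2) * ‖a‖ ^ 2 := by
  rw [← fderiv_fderiv_compY_apply (hf z hz)]
  refine (norm_apply_self_le_of_sSup
    (fun p hp => norm_fderiv_fderiv_compY_le (hf p hp) (hB p hp)) hz _).trans ?_
  rw [WithLp.prod_norm_sq_eq_of_L2, mul_assoc (cY f D)]
  refine mul_le_mul_of_nonneg_left ?_ (cY_nonneg f D)
  have := pow_le_pow_left₀ (norm_nonneg _) (S.le_of_opNorm_le hS a) 2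
  change ‖a‖ ^ 2 + ‖S a‖ ^ 2 ≤ _
  linarith

/-- The blockwise estimate of the second derivative of `f_y` along a slope; the two mixed blocks
agree by symmetry, which accounts for the absence of the factor `1 / 2` in `cY₂`. -/
theorem norm_half_snd_le_blocks (hf : ∀ z ∈ D, ContDiffAt ℝ 2 f z)
    (hB : ∀ z ∈ D, ‖fderiv ℝ (fderiv ℝ f) z‖ ≤ B) (hz : z ∈ D) (hS : ‖S‖ ≤ L)
    (a : EuclideanSpace ℝ (Fin u)) :
    ‖(1 / 2 : ℝ) • (fderiv ℝ (fderiv ℝ f) z (pt a (S a)) (pt a (S a))).snd‖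
      ≤ (cY₁ f D + cY₂ f D * L + cY₃ f D * L ^ 2) * ‖a‖ ^ 2 := by
  rw [← fderiv_fderiv_compY_apply (hf z hz)]
  have hX : ∀ a, ‖inX u s a‖ = ‖a‖ := norm_pt_zero_right
  have hY : ∀ a, ‖inY u s a‖ = ‖a‖ := norm_pt_zero_left
  have hQ := fun p hp => norm_fderiv_fderiv_compY_le (hf p hp) (hB p hp)
  have hB0 : 0 ≤ B := (ContinuousLinearMap.opNorm_nonneg _).trans (hB z hz)
  set Q := fderiv ℝ (fderiv ℝ (compY f)) with hQdef
  have c1 : 1 / 2 * ‖(Q z).bilinearComp (inX u s) (inX u s)‖ ≤ cY₁ f D :=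
    le_csSup ⟨B, by
      rintro _ ⟨p, hp, rfl⟩
      have := norm_bilinearComp_le (Q p) (hQ p hp) hX hX
      change 1 / 2 * _ ≤ _
      linarith⟩ ⟨z, hz, rfl⟩
  have c2 : ‖(Q z).bilinearComp (inX u s) (inY u s)‖ ≤ cY₂ f D :=
    le_csSup ⟨B, by
      rintro _ ⟨p, hp, rfl⟩
      exact norm_bilinearComp_le (Q p) (hQ p hp) hX hY⟩ ⟨z, hz, rfl⟩
  have c3 : 1 / 2 * ‖(Q z).bilinearComp (inY u s) (inY u s)‖ ≤ cY₃ f D :=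
    le_csSup ⟨B, by
      rintro _ ⟨p, hp, rfl⟩
      have := norm_bilinearComp_le (Q p) (hQ p hp) hY hY
      change 1 / 2 * _ ≤ _
      linarith⟩ ⟨z, hz, rfl⟩
  have hsymm : Q z (inY u s (S a)) (inX u s a) = Q z (inX u s a) (inY u s (S a)) := by
    rw [hQdef, fderiv_fderiv_compY_apply (hf z hz), fderiv_fderiv_compY_apply (hf z hz),
      (hf z hz).isSymmSndFDerivAt (by simp)]
  have hdec : (1 / 2 : ℝ) • Q z (pt a (S a)) (pt a (S a))
      = (1 / 2 : ℝ) • (Q z).bilinearComp (inX u s) (inX u s) a a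
        + (Q z).bilinearComp (inX u s) (inY u s) a (S a)
        + (1 / 2 : ℝ) • (Q z).bilinearComp (inY u s) (inY u s) (S a) (S a) := by
    have e : (pt a (S a) : Phase u s) = inX u s a + inY u s (S a) := eq_inX_add_inY _
    rw [e]
    simp only [map_add, add_apply, ContinuousLinearMap.bilinearComp_apply, hsymm]
    module
  have nS : ‖S a‖ ≤ L * ‖a‖ := S.le_of_opNorm_le hS a
  have hL : 0 ≤ L := (norm_nonneg S).trans hS
  have n1 := ((Q z).bilinearComp (inX u s) (inX u s)).le_opNorm₂ a a
  have n2 : ‖(Q z).bilinearComp (inX u s) (inY u s) a (S a)‖ ≤ cY₂ f D * ‖a‖ * (L * ‖a‖) :=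
    (((Q z).bilinearComp (inX u s) (inY u s)).le_opNorm₂ a (S a)).trans (by
      have := cY₂_nonneg f D
      gcongr)
  have n3 := ((Q z).bilinearComp (inY u s) (inY u s)).le_opNorm₂ (S a) (S a)
  have p1 := mul_le_mul_of_nonneg_right c1 (sq_nonneg ‖a‖)
  have p3 : 1 / 2 * ‖(Q z).bilinearComp (inY u s) (inY u s)‖ * ‖S a‖ ^ 2
      ≤ cY₃ f D * (L * ‖a‖) ^ 2 :=
    mul_le_mul c3 (pow_le_pow_left₀ (norm_nonneg _) nS 2) (sq_nonneg _) (cY₃_nonneg f D)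
  rw [hdec]
  refine norm_add₃_le.trans ?_
  rw [norm_smul, norm_smul, Real.norm_of_nonneg (by norm_num : (0 : ℝ) ≤ 1 / 2)]
  linarith

end Forcing

/-- The constants of the theorem are pointwise bounds in the sense of `RateBounds`, for both
admissible choices of the lower bound on `M`. -/
theorem exists_rateBounds (hf : ∀ z ∈ D, ContDiffAt ℝ 2 f z)
    (hbdd : ∀ z ∈ D, ‖fderiv ℝ f z‖ ≤ B ∧ ‖fderiv ℝ (fderiv ℝ f) z‖ ≤ B) {L M : ℝ} (hL : 0 < L)
    (hrate₁ : muRate₁ f D L < xiRate f D L) (hrate₂ : muRate₂ f D L < 2 * xiRate f D L)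
    (hM : (L * cX f D + cY f D) * (1 + L ^ 2) / (2 * xiRate f D L - muRate₂ f D L) < M ∨
      (L * cX f D * (1 + L ^ 2) + cY₁ f D + cY₂ f D * L + cY₃ f D * L ^ 2) /
        (2 * xiRate f D L - muRate₂ f D L) < M) :
    ∃ b m β γ l Γ, RateBounds f D L M b m β γ l Γ := by
  have hd : ∀ z ∈ D, DifferentiableAt ℝ f z := fun z hz => (hf z hz).differentiableAt (by norm_num)
  have hB₁ := fun z hz => (hbdd z hz).1
  have hB₂ := fun z hz => (hbdd z hz).2
  have hgap : 0 < 2 * xiRate f D L - muRate₂ f D L := sub_pos.2 hrate₂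
  have hX := cX_nonneg f D
  have hY := cY_nonneg f D
  have hY₁ := cY₁_nonneg f D
  have hY₂ := cY₂_nonneg f D
  have hY₃ := cY₃_nonneg f D
  have hΓ : ∃ Γ, 0 ≤ Γ ∧ Γ / (2 * xiRate f D L - muRate₂ f D L) < M ∧
      ∀ z ∈ D, ∀ S : EuclideanSpace ℝ (Fin u) →L[ℝ] EuclideanSpace ℝ (Fin s), ‖S‖ ≤ L →
        ∀ a, ‖(1 / 2 : ℝ) • ((fderiv ℝ (fderiv ℝ f) z (pt a (S a)) (pt a (S a))).snd
          - S (fderiv ℝ (fderiv ℝ f) z (pt a (S a)) (pt a (S a))).fst)‖ ≤ Γ * ‖a‖ ^ 2 := by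
    have split : ∀ z ∈ D, ∀ S : EuclideanSpace ℝ (Fin u) →L[ℝ] EuclideanSpace ℝ (Fin s), ‖S‖ ≤ L →
        ∀ a, ‖(1 / 2 : ℝ) • ((fderiv ℝ (fderiv ℝ f) z (pt a (S a)) (pt a (S a))).snd
          - S (fderiv ℝ (fderiv ℝ f) z (pt a (S a)) (pt a (S a))).fst)‖
        ≤ ‖(1 / 2 : ℝ) • (fderiv ℝ (fderiv ℝ f) z (pt a (S a)) (pt a (S a))).snd‖
          + L * (cX f D * (1 + L ^ 2) * ‖a‖ ^ 2) := by
      intro z hz S hS a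
      rw [smul_sub, ← map_smul]
      refine (norm_sub_le _ _).trans (add_le_add le_rfl ((S.le_of_opNorm_le hS _).trans ?_))
      exact mul_le_mul_of_nonneg_left (norm_half_fst_le hf hB₂ hz hS a) hL.le
    rcases hM with hM | hM
    · refine ⟨_, by positivity, hM, fun z hz S hS a => (split z hz S hS a).trans ?_⟩
      have := norm_half_snd_le hf hB₂ hz hS a
      linarith
    · refine ⟨_, by positivity, hM, fun z hz S hS a => (split z hz S hS a).trans ?_⟩
      have := norm_half_snd_le_blocks hf hB₂ hz hS a
      linarith
  obtain ⟨Γ, hΓ0, hΓM, hforce⟩ := hΓ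
  refine ⟨B, sInf ((fun z => logMin (dXX f z)) '' D), sSup ((fun z => ‖dXY f z‖) '' D),
    sSup ((fun z => ‖dYX f z‖) '' D), sSup ((fun z => logNorm (dYY f z)) '' D), Γ, ?_⟩
  refine ⟨hf, hB₁, hB₂, ?_, ?_, ?_, ?_, hforce, hL, (div_nonneg hΓ0 hgap.le).trans hΓM.le, ?_, ?_⟩
  · intro z hz a
    refine le_trans ?_ (logMin_le_inner_map _ a)
    refine mul_le_mul_of_nonneg_right (csInf_le ⟨-B, ?_⟩ ⟨z, hz, rfl⟩) (sq_nonneg _)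
    rintro _ ⟨p, hp, rfl⟩
    exact (neg_le_neg (norm_dXX_le (hd p hp) (hB₁ p hp))).trans (neg_norm_le_logMin _)
  · intro z hz
    refine le_csSup ⟨B, ?_⟩ ⟨z, hz, rfl⟩
    rintro _ ⟨p, hp, rfl⟩
    exact norm_dXY_le (hd p hp) (hB₁ p hp)
  · intro z hz
    refine le_csSup ⟨B, ?_⟩ ⟨z, hz, rfl⟩
    rintro _ ⟨p, hp, rfl⟩
    exact norm_dYX_le (hd p hp) (hB₁ p hp)
  · intro z hz a
    refine (inner_map_le_logNorm _ a).trans ?_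
    refine mul_le_mul_of_nonneg_right (le_csSup ⟨B, ?_⟩ ⟨z, hz, rfl⟩) (sq_nonneg _)
    rintro _ ⟨p, hp, rfl⟩
    exact (logNorm_le_norm _).trans (norm_dYY_le (hd p hp) (hB₁ p hp))
  · have h1 := mul_lt_mul_of_pos_left hrate₁ hL
    have h2 : L * muRate₁ f D L = sSup ((fun z => logNorm (dYY f z)) '' D) * L
        + sSup ((fun z => ‖dYX f z‖) '' D) := by
      rw [muRate₁]
      field_simp
    rw [h2, xiRate] at h1
    exact h1
  · rw [div_lt_iff₀ hgap, xiRate, muRate₂] at hΓM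
    exact hΓM

end Constants

end SecondDerivBound

theorem mainTheorem4 (u s : ℕ)
    (f : SecondDerivBound.Phase u s → SecondDerivBound.Phase u s)
    (D : Set (SecondDerivBound.Phase u s))
    (hf : ∀ z ∈ D, ContDiffAt ℝ 3 f z)
    (hbdd : ∃ B : ℝ, ∀ z ∈ D, ‖fderiv ℝ f z‖ ≤ B ∧ ‖fderiv ℝ (fderiv ℝ f) z‖ ≤ B)
    (L : ℝ) (hL : 0 < L)
    (w : EuclideanSpace ℝ (Fin u) → EuclideanSpace ℝ (Fin s))
    (h₀ : ℝ) (hh₀ : 0 < h₀)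
    (hw : ∀ h : ℝ, 0 < h → h ≤ h₀ → SecondDerivBound.IsGraphLimit f D h w)
    (hrate₁ : SecondDerivBound.muRate₁ f D L < SecondDerivBound.xiRate f D L)
    (hrate₂ : SecondDerivBound.muRate₂ f D L < 2 * SecondDerivBound.xiRate f D L)
    (M : ℝ)
    (hM :
      (L * SecondDerivBound.cX f D + SecondDerivBound.cY f D) * (1 + L ^ 2) /
          (2 * SecondDerivBound.xiRate f D L - SecondDerivBound.muRate₂ f D L) < M ∨
      (L * SecondDerivBound.cX f D * (1 + L ^ 2) + SecondDerivBound.cY₁ f D +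
            SecondDerivBound.cY₂ f D * L + SecondDerivBound.cY₃ f D * L ^ 2) /
          (2 * SecondDerivBound.xiRate f D L - SecondDerivBound.muRate₂ f D L) < M)
    (K : Set (EuclideanSpace ℝ (Fin u))) (hK : Convex ℝ K) (hKint : (interior K).Nonempty)
    (hKD : K ⊆ SecondDerivBound.projX D) (x : EuclideanSpace ℝ (Fin u)) (hx : x ∈ K) :
    DifferentiableWithinAt ℝ w K x ∧
    (∀ v : EuclideanSpace ℝ (Fin u), x + v ∈ K →
      ‖w (x + v) - w x - fderivWithin ℝ w K x v‖ ≤ M * ‖v‖ ^ 2) ∧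
    (DifferentiableWithinAt ℝ (fderivWithin ℝ w K) K x →
      ∀ v : EuclideanSpace ℝ (Fin u),
        ‖(1 / 2 : ℝ) • fderivWithin ℝ (fderivWithin ℝ w K) K x v v‖ ≤ M * ‖v‖ ^ 2) := by
  obtain ⟨B, hB⟩ := hbdd
  have hf2 : ∀ z ∈ D, ContDiffAt ℝ 2 f z := fun z hz => (hf z hz).of_le (by norm_num)
  obtain ⟨b, m, β, γ, l, Γ, H⟩ :=
    SecondDerivBound.exists_rateBounds hf2 hB hL hrate₁ hrate₂ hM
  -- A single step size is enough: the estimates hold along trajectories of any length.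
  obtain ⟨V, hV0, hV, hlim⟩ := hw h₀ hh₀ le_rfl
  have hslope := H.exists_quadraticSlope_iterate hh₀.le hV0 hV
  choose! S hS using hslope
  have hKlim : ∀ x ∈ K, Tendsto (fun n => V n x) atTop (𝓝 (w x)) := fun x hx => hlim x (hKD hx)
  have hA : ∀ x ∈ K, ∃ A : EuclideanSpace ℝ (Fin u) →L[ℝ] EuclideanSpace ℝ (Fin s),
      ∀ v, x + v ∈ K → ‖w (x + v) - w x - A v‖ ≤ M * ‖v‖ ^ 2 := fun x hx =>
    SecondDerivBound.exists_slope_of_tendsto hKlim hx (fun n => (hS n x (hKD hx)).1)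
      fun n v hv => SecondDerivBound.norm_taylor_le_of_quadraticSlope hK hKD H.nonneg (hS n) hx hv
  choose! A hA using hA
  have hder : ∀ x ∈ K, HasFDerivWithinAt w (A x) K x := fun x hx =>
    SecondDerivBound.hasFDerivWithinAt_of_quadratic_bound (M := M) hx
      (eventually_mem_nhdsWithin.mono fun x' hx' => by
        simpa using hA x hx (x' - x) (by simpa using hx'))
  have hfd : ∀ x ∈ K, fderivWithin ℝ w K x = A x := fun x hx =>
    (hder x hx).fderivWithin (uniqueDiffOn_convex hK hKint x hx)
  have hTaylor : ∀ x ∈ K, ∀ v, x + v ∈ K →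
      ‖w (x + v) - w x - fderivWithin ℝ w K x v‖ ≤ M * ‖v‖ ^ 2 := fun x hx v hv => by
    rw [hfd x hx]
    exact hA x hx v hv
  exact ⟨(hder x hx).differentiableWithinAt, hTaylor x hx,
    SecondDerivBound.norm_second_fderivWithin_le hK hKint
      (fun y hy => (hder y hy).differentiableWithinAt) hTaylor hx⟩
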